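/- Let $A$ be a finite alphabet. Words $w\in A^*$ are viewed as structures whose domain is the set of positions of $w$, with a unary predicate $P_a$ for each $a\in A$ (positions labelled $a$) and the linear order $<$ of positions. For $i\ge 0$, a first-order sentence over this signature is $\Sigma_i$ (resp. $\Pi_i$) if pulling its quantifiers to the front yields a prenex formula with at most $i$ blocks of quantifiers, the first of which, when there are $i\ge 1$ of them, is existential (resp. universal). A language $L\subseteq A^*$ is $\Sigma_i$-definable (resp. $\Pi_i$-definable) if it is the set of words satisfying some $\Sigma_i$ (resp. $\Pi_i$) sentence, and $\Delta_i$-definable if it is both $\Sigma_i$-definable and $\Pi_i$-definable. For $w,w'\in A^*$ write $w\lesssim_i^k w'$ if every $\Sigma_i$ sentence of quantifier rank at most $k$ satisfied by $w$ is also satisfied by $w'$. For a morphism $\alpha:A^*\to M$ into a monoid, a pair $(t,s)\in M^2$ is a $\Sigma_i$-chain for $\alpha$ if $i=0$, or if $i\ge 1$ and for every $k\in\mathbb N$ there are words $v,u\in A^*$ with $v\lesssim_i^k u$, $\alpha(v)=t$ and $\alpha(u)=s$. For a language $L$ put $w\le_L w'$ if for all $u,v\in A^*$, $uwv\in L\Rightarrow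 uw'v\in L$, and $w\equiv_L w'$ if $w\le_L w'$ and $w'\le_L w$. The syntactic monoid of $L$ is $M=A^*/{\equiv_L}$, ordered by the partial order $\le$ induced by $\le_L$, and the syntactic morphism $\alpha:A^*\to M$ is the canonical projection. If $L$ is regular then $M$ is finite; let $\omega\ge 1$ be such that $s^\omega$ is idempotent for every $s\in M$. Let $L\subseteq A^*$ be a regular language with syntactic morphism $\alpha:A^*\to M$, and let $i\ge 1$. Then: 1. $L$ is $\Pi_i$-definable if and only if $s^\omega\ge s^\omega t s^\omega$ for every $\Sigma_{i-1}$-chain $(t,s)$ for $\alpha$. 2. $L$ is $\Delta_i$-definable if and only if $s^\omega= s^\omega t s^\omega$ for every $\Sigma_{i-1}$-chain $(t,s)$ for $\alpha$. -/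

import Mathlib

universe u v

namespace WordLogic

section Logic

/-- Relation symbols of first-order logic `FO(<)` over words: a unary predicate `P_a` for every
letter `a`, and the binary predicate `<`. -/
inductive WordRel (A : Type u) : ℕ → Type u
  | letter (a : A) : WordRel A 1
  | lt : WordRel A 2

/-- The (purely relational) first-order signature of words over `A`. -/
def wordLang (A : Type u) : FirstOrder.Language.{0, u} :=
  ⟨fun _ => Empty, WordRel A⟩

/-- A word seen as a logical structure: its domain is the set of positions of the word. -/
@[reducible]
def wordStructure {A : Type u} (w : List A) : (wordLang A).Structure (Fin w.length) where
  funMap := fun f _ => nomatch f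
  RelMap := fun r x =>
    match r, x with
    | .letter a, x => w.get (x 0) = a
    | .lt, x => x 0 < x 1

/-- The word `w` satisfies the sentence `φ` of `FO(<)`. -/
def Satisfies {A : Type u} (w : List A) (φ : (wordLang A).Sentence) : Prop :=
  letI := wordStructure w
  φ.Realize (Fin w.length)

/-- The quantifier rank: the length of the longest sequence of nested quantifiers. -/
def quantifierRank {A : Type u} {α : Type v} :
    {n : ℕ} → (wordLang A).BoundedFormula α n → ℕ
  | _, .falsum => 0
  | _, .equal _ _ => 0
  | _, .rel _ _ => 0
  | _, .imp φ ψ => max (quantifierRank φ) (quantifierRank ψ)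
  | _, .all φ => quantifierRank φ + 1

mutual

/-- The least `i` such that `φ`, once its quantifiers are pulled out to the front, is a formula with
at most `i` blocks of quantifiers of which the first (if there are `i` of them) is existential.
In `φ → ψ` the quantifiers of `φ` are dualized when they are pulled out, and blocks of the same kind
coming from `φ` and `ψ` are merged. Since `∃ x, φ` is `¬ ∀ x, ¬ φ`, and `¬ φ` is `φ → ⊥`, this gives
`sigmaLevel (∃ x, φ) = max 1 (sigmaLevel φ)`. -/
def sigmaLevel {A : Type u} {α : Type v} :
    {n : ℕ} → (wordLang A).BoundedFormula α n → ℕ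
  | _, .falsum => 0
  | _, .equal _ _ => 0
  | _, .rel _ _ => 0
  | _, .imp φ ψ => max (piLevel φ) (sigmaLevel ψ)
  | _, .all φ => max 1 (piLevel φ) + 1

/-- The least `i` such that `φ`, once its quantifiers are pulled out to the front, is a formula with
at most `i` blocks of quantifiers of which the first (if there are `i` of them) is universal. -/
def piLevel {A : Type u} {α : Type v} :
    {n : ℕ} → (wordLang A).BoundedFormula α n → ℕ
  | _, .falsum => 0
  | _, .equal _ _ => 0
  | _, .rel _ _ => 0
  | _, .imp φ ψ => max (sigmaLevel φ) (piLevel ψ)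
  | _, .all φ => max 1 (piLevel φ)

end

/-- `φ` is a `Σ_i` sentence. -/
def IsSigma {A : Type u} (i : ℕ) (φ : (wordLang A).Sentence) : Prop :=
  sigmaLevel φ ≤ i

/-- `φ` is a `Π_i` sentence. -/
def IsPi {A : Type u} (i : ℕ) (φ : (wordLang A).Sentence) : Prop :=
  piLevel φ ≤ i

/-- The sentence `φ` defines the language `L`. -/
def Defines {A : Type u} (φ : (wordLang A).Sentence) (L : Language A) : Prop :=
  ∀ w : List A, w ∈ L ↔ Satisfies w φ

/-- `L` is `Σ_i`-definable. -/
def SigmaDefinable {A : Type u} (i : ℕ) (L : Language A) : Prop :=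
  ∃ φ : (wordLang A).Sentence, IsSigma i φ ∧ Defines φ L

/-- `L` is `Π_i`-definable. -/
def PiDefinable {A : Type u} (i : ℕ) (L : Language A) : Prop :=
  ∃ φ : (wordLang A).Sentence, IsPi i φ ∧ Defines φ L

/-- `L` is `Δ_i`-definable: it is defined both by a `Σ_i` and by a `Π_i` sentence. -/
def DeltaDefinable {A : Type u} (i : ℕ) (L : Language A) : Prop :=
  SigmaDefinable i L ∧ PiDefinable i L

/-- The preorder of `Σ_i` at rank `k`: every `Σ_i` sentence of quantifier rank at most `k` that is
satisfied by `w` is satisfied by `w'`. -/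
def SigmaLE {A : Type u} (k i : ℕ) (w w' : List A) : Prop :=
  ∀ φ : (wordLang A).Sentence,
    IsSigma i φ → quantifierRank φ ≤ k → Satisfies w φ → Satisfies w' φ

/-- `(s_1, …, s_n)` is a `Σ_i`-chain for the morphism `α`. For `i = 0` all tuples are chains; for
`i ≥ 1` it means that for every `k` there are words `w_1 ≤ ⋯ ≤ w_n` (for the preorder of `Σ_i` at
rank `k`) that `α` maps to `s_1, …, s_n`. -/
def IsSigmaChain {A : Type u} {M : Type v} [Monoid M] (i : ℕ) (α : FreeMonoid A →* M)
    (s : List M) : Prop :=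
  match i with
  | 0 => True
  | j + 1 => ∀ k : ℕ, ∃ w : List (FreeMonoid A),
      w.IsChain (fun x y => SigmaLE k (j + 1) x.toList y.toList) ∧ w.map α = s

end Logic

section Algebra

/-- The syntactic preorder of `L`: `w ≤ w'` iff `u w v ∈ L` implies `u w' v ∈ L` for all `u, v`. -/
def SyntacticLE {A : Type u} (L : Language A) (w w' : FreeMonoid A) : Prop :=
  ∀ u v : FreeMonoid A, (u * w * v).toList ∈ L → (u * w' * v).toList ∈ L

theorem SyntacticLE.refl {A : Type u} (L : Language A) (w : FreeMonoid A) : SyntacticLE L w w :=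
  fun _ _ h => h

theorem SyntacticLE.trans {A : Type u} {L : Language A} {w₁ w₂ w₃ : FreeMonoid A}
    (h : SyntacticLE L w₁ w₂) (h' : SyntacticLE L w₂ w₃) : SyntacticLE L w₁ w₃ :=
  fun u v huv => h' u v (h u v huv)

theorem SyntacticLE.mul {A : Type u} {L : Language A} {w₁ w₂ x₁ x₂ : FreeMonoid A}
    (h : SyntacticLE L w₁ w₂) (h' : SyntacticLE L x₁ x₂) :
    SyntacticLE L (w₁ * x₁) (w₂ * x₂) := by
  intro u v huv
  have h1 := h u (x₁ * v) (by simpa only [mul_assoc] using huv)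
  have h2 := h' (u * w₂) v (by simpa only [mul_assoc] using h1)
  simpa only [mul_assoc] using h2

/-- The syntactic equivalence of `L`, a congruence on the free monoid. -/
def syntacticCon {A : Type u} (L : Language A) : Con (FreeMonoid A) where
  r w w' := SyntacticLE L w w' ∧ SyntacticLE L w' w
  iseqv := ⟨fun w => ⟨.refl L w, .refl L w⟩, fun h => ⟨h.2, h.1⟩,
    fun h h' => ⟨h.1.trans h'.1, h'.2.trans h.2⟩⟩
  mul' h h' := ⟨h.1.mul h'.1, h.2.mul h'.2⟩

/-- The syntactic monoid of `L`. -/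
abbrev SyntacticMonoid {A : Type u} (L : Language A) : Type u := (syntacticCon L).Quotient

/-- The syntactic morphism of `L`. -/
def syntacticMorphism {A : Type u} (L : Language A) : FreeMonoid A →* SyntacticMonoid L :=
  (syntacticCon L).mk'

/-- The order of the syntactic monoid, induced by the syntactic preorder. -/
instance syntacticPartialOrder {A : Type u} (L : Language A) :
    PartialOrder (SyntacticMonoid L) where
  le s t := Con.liftOn₂ s t (SyntacticLE L) fun _ _ _ _ h h' => propext
    ⟨fun hw => (h.2.trans hw).trans h'.1, fun hw => (h.1.trans hw).trans h'.2⟩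
  le_refl s := by
    induction s using Con.induction_on with | H w => exact SyntacticLE.refl L w
  le_trans s t r := by
    induction s using Con.induction_on
    induction t using Con.induction_on
    induction r using Con.induction_on
    exact SyntacticLE.trans
  le_antisymm s t := by
    induction s using Con.induction_on
    induction t using Con.induction_on
    exact fun h h' => (Con.eq _).2 ⟨h, h'⟩

open Classical in
/-- The number `ω` of a monoid `M`: the least `n ≥ 1` such that `s ^ n` is idempotent for every
`s : M`. It exists if `M` is finite (and is set to `0` if there is no such `n`). -/
noncomputable def omegaExp (M : Type v) [Monoid M] : ℕ :=
  if h : ∃ n : ℕ, 1 ≤ n ∧ ∀ s : M, IsIdempotentElem (s ^ n) then Nat.find h else 0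

end Algebra

end WordLogic

open WordLogic

-- The preorder of `Σ_i` at rank `k` is replaced by an Ehrenfeucht–Fraïssé game on words: once a
-- letter is chosen, the words break into independent left and right factors. In this form the
-- preorder is compatible with concatenation and has finitely many classes at each rank.
-- `Σ_i`-definability of `L` becomes closure of `L` upwards under the game preorder at some rank,
-- and `Π_i`-definability closure downwards (`sigmaDefinable_iff`, `piDefinable_iff`).
--
-- Write `j = i - 1`. The conditions are necessary because `v ≲_j u` implies that a long power of
-- `u` is below any product of a long power of `u`, then `v`, then a long power of `u`, at level `j
-- + 1` (`WSim.wordPow_insert`). The images of the two sides are `s^ω` and `s^ω t s^ω`, and closure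
-- of `L` in every context gives the inequality.
--
-- For sufficiency, finiteness of the monoid gives one rank `k` at which `x ≲_j u` already forces a
-- chain, so the condition becomes an `InsertionOrder`. What is needed is a rank `K`, independent of
-- `w`, with `w ≲_{j+1} w'` at rank `K` implying `f w ≤ f w'`. Concatenation costs rank, so the
-- number of cuts in `w` must be bounded. The saving is `isMonotoneAt_insert`: if `f m` acts as an
-- identity to the right of `f x` and to the left of `f y`, then `x m y` is monotone with no
-- assumption on `m`.
--
-- Such factors come from Green's relations. By induction down the `J`-order, a word is cut into
-- blocks, each of which drops out of the classes already treated; inside one `J`-class, the factor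
-- between the first and the last border with given `L`- and `R`-classes acts as an identity on both
-- sides (`mul_eq_of_ideals`). Each such step eliminates one of finitely many border types.
-- Reversing the order treats `Π`, and the two inequalities together give `Δ`.

namespace WordLogic

-- Recursive Ehrenfeucht–Fraïssé games on words

section Simulation

variable {B : Type*} {C : Type*}

/-- The Ehrenfeucht–Fraïssé preorder of `Σ_i` at rank `k` on words, in its recursive form: after a
letter has been chosen in both words, the game splits into a game to its left and a game to its
right. The letters satisfying `D` have to agree from the start. -/
def Sim (D : B → Bool) : ℕ → ℕ → List B → List B → Prop
  | 0, _, w, w' => w.filter D = w'.filter D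
  | _ + 1, 0, w, w' => w.filter D = w'.filter D
  | k + 1, i + 1, w, w' => w.filter D = w'.filter D ∧
      (∀ x b y, w = x ++ b :: y →
        ∃ x' y', w' = x' ++ b :: y' ∧ Sim D k (i + 1) x x' ∧ Sim D k (i + 1) y y') ∧
      (0 < i → ∀ x' b y', w' = x' ++ b :: y' →
        ∃ x y, w = x ++ b :: y ∧ Sim D k i x' x ∧ Sim D k i y' y)

namespace Sim

variable {D : B → Bool} {k i : ℕ} {w w' w'' : List B}

theorem filter_eq (h : Sim D k i w w') : w.filter D = w'.filter D := by
  rcases k with _ | k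
  · exact h
  · rcases i with _ | i
    · exact h
    · exact h.1

theorem zero_right_iff : Sim D k 0 w w' ↔ w.filter D = w'.filter D := by
  cases k <;> rfl

theorem refl (D : B → Bool) (k i : ℕ) (w : List B) : Sim D k i w w := by
  induction k generalizing i w with
  | zero => rfl
  | succ k ih =>
    cases i with
    | zero => rfl
    | succ i =>
      exact ⟨rfl, fun x b y h => ⟨x, y, h, ih _ _, ih _ _⟩,
        fun _ x b y h => ⟨x, y, h, ih _ _, ih _ _⟩⟩

theorem trans (h : Sim D k i w w') (h' : Sim D k i w' w'') : Sim D k i w w'' := by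
  induction k generalizing i w w' w'' with
  | zero => exact Eq.trans h h'
  | succ k ih =>
    cases i with
    | zero => exact Eq.trans h h'
    | succ i =>
      refine ⟨h.1.trans h'.1, fun x b y e => ?_, fun hi x b y e => ?_⟩
      · obtain ⟨x', y', e', hx, hy⟩ := h.2.1 x b y e
        obtain ⟨x'', y'', e'', hx', hy'⟩ := h'.2.1 x' b y' e'
        exact ⟨x'', y'', e'', ih hx hx', ih hy hy'⟩
      · obtain ⟨x', y', e', hx, hy⟩ := h'.2.2 hi x b y e
        obtain ⟨x'', y'', e'', hx', hy'⟩ := h.2.2 hi x' b y' e'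
        exact ⟨x'', y'', e'', ih hx hx', ih hy hy'⟩

theorem of_succ_rank (h : Sim D (k + 1) i w w') : Sim D k i w w' := by
  induction k generalizing i w w' with
  | zero => exact h.filter_eq
  | succ k ih =>
    cases i with
    | zero => exact h
    | succ i =>
      refine ⟨h.1, fun x b y e => ?_, fun hi x b y e => ?_⟩
      · obtain ⟨x', y', e', hx, hy⟩ := h.2.1 x b y e
        exact ⟨x', y', e', ih hx, ih hy⟩
      · obtain ⟨x', y', e', hx, hy⟩ := h.2.2 hi x b y e
        exact ⟨x', y', e', ih hx, ih hy⟩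

theorem mono_rank {l : ℕ} (hkl : k ≤ l) (h : Sim D l i w w') : Sim D k i w w' := by
  induction hkl with
  | refl => exact h
  | step _ ih => exact ih h.of_succ_rank

theorem of_succ_level (h : Sim D k (i + 1) w w') : Sim D k i w w' := by
  induction k generalizing i w w' with
  | zero => exact h
  | succ k ih =>
    cases i with
    | zero => exact h.1
    | succ i =>
      refine ⟨h.1, fun x b y e => ?_, fun hi x b y e => ?_⟩
      · obtain ⟨x', y', e', hx, hy⟩ := h.2.1 x b y e
        exact ⟨x', y', e', ih hx, ih hy⟩
      · obtain ⟨x', y', e', hx, hy⟩ := h.2.2 (Nat.succ_pos _) x b y e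
        exact ⟨x', y', e', ih hx, ih hy⟩

theorem swap (h : Sim D k (i + 1) w w') : Sim D k i w' w := by
  cases k with
  | zero => exact Eq.symm h
  | succ k =>
    cases i with
    | zero => exact h.1.symm
    | succ i =>
      refine ⟨h.1.symm, fun x b y e => h.2.2 (Nat.succ_pos _) x b y e, fun hi x b y e => ?_⟩
      obtain ⟨x', y', e', hx, hy⟩ := h.2.1 x b y e
      exact ⟨x', y', e', hx.of_succ_level.of_succ_level, hy.of_succ_level.of_succ_level⟩

/-- The second half of the game is the game with the roles exchanged, one level below. -/
theorem intro (hf : w.filter D = w'.filter D)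
    (h : ∀ x b y, w = x ++ b :: y →
      ∃ x' y', w' = x' ++ b :: y' ∧ Sim D k (i + 1) x x' ∧ Sim D k (i + 1) y y')
    (h' : Sim D (k + 1) i w' w) : Sim D (k + 1) (i + 1) w w' := by
  refine ⟨hf, h, fun hi x b y e => ?_⟩
  obtain ⟨j, rfl⟩ : ∃ j, i = j + 1 := ⟨i - 1, by omega⟩
  exact h'.2.1 x b y e

/-- The two games are played side by side: a move falls in one factor, and the other factor is kept
whole with its rank lowered. After a move in the second word the roles are exchanged, hence the use
of `swap` on the untouched factor. -/
theorem append {v v' : List B} (h : Sim D k i w w') (h' : Sim D k i v v') :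
    Sim D k i (w ++ v) (w' ++ v') := by
  have split : ∀ {p q x y : List B} {b : B}, p ++ q = x ++ b :: y →
      (∃ r, p = x ++ b :: r ∧ y = r ++ q) ∨ ∃ r, x = p ++ r ∧ q = r ++ b :: y := by
    intro p q x y b e
    rcases List.append_eq_append_iff.1 e with ⟨r, rfl, hr⟩ | ⟨r, rfl, hr⟩
    · exact Or.inr ⟨r, rfl, hr⟩
    · cases r with
      | nil => exact Or.inr ⟨[], by simp, by simpa using hr.symm⟩
      | cons c r =>
        simp only [List.cons_append, List.cons.injEq] at hr
        obtain ⟨rfl, rfl⟩ := hr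
        exact Or.inl ⟨r, rfl, rfl⟩
  have hf : (w ++ v).filter D = (w' ++ v').filter D := by
    rw [List.filter_append, List.filter_append, h.filter_eq, h'.filter_eq]
  induction k generalizing i w w' v v' with
  | zero => exact hf
  | succ k ih =>
    have ih' : ∀ {i w w' v v'}, Sim D k i w w' → Sim D k i v v' → Sim D k i (w ++ v) (w' ++ v') :=
      fun h h' => ih h h' (by rw [List.filter_append, List.filter_append, h.filter_eq, h'.filter_eq])
    cases i with
    | zero => exact hf
    | succ i =>
      refine ⟨hf, fun x b y e => ?_, fun hi x b y e => ?_⟩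
      · rcases split e with ⟨r, e1, rfl⟩ | ⟨r, rfl, e1⟩
        · obtain ⟨x', y', rfl, hx, hy⟩ := h.2.1 _ _ _ e1
          exact ⟨x', y' ++ v', by simp, hx, ih' hy h'.of_succ_rank⟩
        · obtain ⟨x', y', rfl, hx, hy⟩ := h'.2.1 _ _ _ e1
          exact ⟨w' ++ x', y', by simp, ih' h.of_succ_rank hx, hy⟩
      · rcases split e with ⟨r, e1, rfl⟩ | ⟨r, rfl, e1⟩
        · obtain ⟨x', y', rfl, hx, hy⟩ := h.2.2 hi _ _ _ e1
          exact ⟨x', y' ++ v, by simp, hx, ih' hy h'.of_succ_rank.swap⟩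
        · obtain ⟨x', y', rfl, hx, hy⟩ := h'.2.2 hi _ _ _ e1
          exact ⟨w ++ x', y', by simp, ih' h.of_succ_rank.swap hx, hy⟩

/-- One move is spent on the first letter of `v`, which costs one rank; this letter is then put back
in front of the right factor. -/
theorem exists_append {v : List B} (h : Sim D (k + 1) (i + 1) (w ++ v) w') :
    ∃ x y, w' = x ++ y ∧ Sim D k (i + 1) w x ∧ Sim D k (i + 1) v y := by
  cases v with
  | nil => exact ⟨w', [], by simp, by simpa using h.of_succ_rank, refl _ _ _ _⟩
  | cons b v =>
    obtain ⟨x, y, rfl, hx, hy⟩ := h.2.1 _ _ _ rfl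
    exact ⟨x, b :: y, rfl, hx, (refl D k (i + 1) [b]).append hy⟩

theorem map {D' : C → Bool} (f : B → C) (hf : ∀ b, D' (f b) = D b) (h : Sim D k i w w') :
    Sim D' k i (w.map f) (w'.map f) := by
  have hfil : ∀ {w w' : List B}, w.filter D = w'.filter D →
      (w.map f).filter D' = (w'.map f).filter D' := by
    intro w w' h
    have : D' ∘ f = D := funext hf
    rw [List.filter_map, List.filter_map, this, h]
  induction k generalizing i w w' with
  | zero => exact hfil h
  | succ k ih =>
    cases i with
    | zero => exact hfil h
    | succ i =>
      refine ⟨hfil h.1, fun x b y e => ?_, fun hi x b y e => ?_⟩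
      · obtain ⟨x, z, rfl, rfl, e₁⟩ := List.map_eq_append_iff.1 e
        obtain ⟨b, y, rfl, rfl, rfl⟩ := List.map_eq_cons_iff.1 e₁
        obtain ⟨x', y', rfl, hx, hy⟩ := h.2.1 _ _ _ rfl
        exact ⟨x'.map f, y'.map f, by simp, ih hx, ih hy⟩
      · obtain ⟨x, z, rfl, rfl, e₁⟩ := List.map_eq_append_iff.1 e
        obtain ⟨b, y, rfl, rfl, rfl⟩ := List.map_eq_cons_iff.1 e₁
        obtain ⟨x', y', rfl, hx, hy⟩ := h.2.2 hi _ _ _ rfl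
        exact ⟨x'.map f, y'.map f, by simp, ih hx, ih hy⟩

end Sim

/-- The power of a word. -/
def wordPow (u : List B) (n : ℕ) : List B := (List.replicate n u).flatten

theorem wordPow_succ (u : List B) (n : ℕ) : wordPow u (n + 1) = u ++ wordPow u n := rfl

theorem wordPow_add (u : List B) (m n : ℕ) : wordPow u (m + n) = wordPow u m ++ wordPow u n := by
  rw [wordPow, wordPow, wordPow, List.replicate_add, List.flatten_append]

theorem wordPow_one (u : List B) : wordPow u 1 = u := by simp [wordPow]

theorem wordPow_eq_append_cons {u : List B} {n : ℕ} {x y : List B} {b : B}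
    (h : wordPow u n = x ++ b :: y) :
    ∃ m l p q, m + 1 + l = n ∧ u = p ++ b :: q ∧ x = wordPow u m ++ p ∧ y = q ++ wordPow u l := by
  induction n generalizing x with
  | zero => simp [wordPow] at h
  | succ n ih =>
    rw [wordPow_succ] at h
    rcases List.append_eq_append_iff.1 h with ⟨r, rfl, hr⟩ | ⟨r, hu, hr⟩
    · obtain ⟨m, l, p, q, e, hu, rfl, rfl⟩ := ih hr
      exact ⟨m + 1, l, p, q, by omega, hu, by simp [wordPow_succ], rfl⟩
    · cases r with
      | nil =>
        obtain ⟨m, l, p, q, e, hu', hx, rfl⟩ := ih (x := []) (by simpa using hr.symm)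
        refine ⟨m + 1, l, p, q, by omega, hu', ?_, rfl⟩
        rw [wordPow_succ, List.append_assoc, ← hx, hu]
        simp
      | cons c r =>
        simp only [List.cons_append, List.cons.injEq] at hr
        obtain ⟨rfl, rfl⟩ := hr
        exact ⟨0, n, x, r, by omega, hu, by simp [wordPow], rfl⟩

theorem wordPow_split {u p q : List B} {b : B} (hu : u = p ++ b :: q) (m l : ℕ) :
    wordPow u (m + 1 + l) = (wordPow u m ++ p) ++ b :: (q ++ wordPow u l) := by
  rw [wordPow_add, wordPow_add, wordPow_one]
  conv_lhs => enter [1, 2]; rw [hu]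
  simp

/-- The preorder of `Σ_i` at rank `k`, for words without distinguished letters. -/
abbrev WSim (k i : ℕ) (w w' : List B) : Prop := Sim (fun _ => false) k i w w'

/-- The threshold `2 ^ k - 1` satisfies `2 ^ (k + 1) - 1 = (2 ^ k - 1) + 1 + (2 ^ k - 1)`: when a
move lands in one copy of `u`, a short side is matched exactly, and a long side only has to stay
long. -/
theorem WSim.wordPow_of_le (u : List B) (k : ℕ) : ∀ (i m n : ℕ), 2 ^ k ≤ m + 1 → 2 ^ k ≤ n + 1 →
    WSim k i (wordPow u m) (wordPow u n) := by
  induction k with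
  | zero => intro i m n _ _; simp [WSim, Sim]
  | succ k ih =>
    intro i
    induction i with
    | zero => intro m n _ _; simp [WSim, Sim]
    | succ i ihi =>
      intro m n hm hn
      rw [pow_succ] at hm hn
      have hk : 1 ≤ 2 ^ k := Nat.one_le_two_pow
      refine Sim.intro (by simp) (fun x b y e => ?_) (ihi n m ?_ ?_)
      · obtain ⟨c, d, p, q, e, hu, rfl, rfl⟩ := wordPow_eq_append_cons e
        obtain ⟨c', d', e', hc, hd⟩ : ∃ c' d', c' + 1 + d' = n ∧
            (c = c' ∨ 2 ^ k ≤ c + 1 ∧ 2 ^ k ≤ c' + 1) ∧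
            (d = d' ∨ 2 ^ k ≤ d + 1 ∧ 2 ^ k ≤ d' + 1) := by
          by_cases h1 : 2 ^ k ≤ c + 1
          · by_cases h2 : 2 ^ k ≤ d + 1
            · exact ⟨2 ^ k - 1, n - 2 ^ k, by omega, by omega, by omega⟩
            · exact ⟨n - 1 - d, d, by omega, by omega, by omega⟩
          · exact ⟨c, n - 1 - c, by omega, by omega, by omega⟩
        have key : ∀ {c c'}, (c = c' ∨ 2 ^ k ≤ c + 1 ∧ 2 ^ k ≤ c' + 1) →
            WSim k (i + 1) (wordPow u c) (wordPow u c') := by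
          rintro c c' (rfl | ⟨h, h'⟩)
          · exact Sim.refl _ _ _ _
          · exact ih _ _ _ h h'
        exact ⟨_, _, by rw [← e']; exact wordPow_split hu c' d', (key hc).append (Sim.refl _ _ _ p),
          (Sim.refl _ _ _ q).append (key hd)⟩
      all_goals rw [pow_succ]; omega

/-- For moves in the second word, `v` is first replaced by `u`, which leaves two long powers of `u`.
A move in the power on the left leaves many copies of `u` on at least one side, and the insertion is
hidden on that side. -/
theorem WSim.wordPow_insert {u v : List B} (k i : ℕ) (huv : WSim k i v u) : ∀ (l m n : ℕ),
    2 ^ k ≤ l + 1 → 2 ^ k ≤ m + 1 → 2 ^ k ≤ n + 1 →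
    WSim k (i + 1) (wordPow u l) (wordPow u m ++ v ++ wordPow u n) := by
  induction k with
  | zero => intro l m n _ _ _; simp [WSim, Sim]
  | succ k ih =>
    intro l m n hl hm hn
    have back : WSim (k + 1) i (wordPow u m ++ v ++ wordPow u n) (wordPow u l) := by
      refine Sim.trans (((Sim.refl _ _ _ _).append huv).append (Sim.refl _ _ _ _)) ?_
      have : wordPow u m ++ u ++ wordPow u n = wordPow u (m + 1 + n) := by
        rw [wordPow_add, wordPow_add, wordPow_one]
      rw [this]
      exact WSim.wordPow_of_le _ _ _ _ _ (by omega) hl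
    specialize ih huv.of_succ_rank
    rw [pow_succ] at hl hm hn
    have hk : 1 ≤ 2 ^ k := Nat.one_le_two_pow
    refine Sim.intro (by simp) (fun x b y e => ?_) back
    obtain ⟨c, d, p, q, e, hu, rfl, rfl⟩ := wordPow_eq_append_cons e
    -- Long powers are truncated to exactly `2 ^ k - 1` copies, so that enough copies remain next to
    -- `v`.
    have key : ∀ c, ∃ c', (c' = c ∧ c + 1 < 2 ^ k ∨ c' + 1 = 2 ^ k ∧ 2 ^ k ≤ c + 1) ∧
        WSim k (i + 1) (wordPow u c) (wordPow u c') := by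
      intro c
      by_cases hc : 2 ^ k ≤ c + 1
      · exact ⟨2 ^ k - 1, by omega, WSim.wordPow_of_le _ _ _ _ _ hc (by omega)⟩
      · exact ⟨c, by omega, Sim.refl _ _ _ _⟩
    by_cases hd : 2 ^ k ≤ d + 1
    · obtain ⟨c', hc', hs⟩ := key c
      refine ⟨wordPow u c' ++ p, q ++ (wordPow u (m - 1 - c') ++ v ++ wordPow u n), ?_,
        hs.append (Sim.refl _ _ _ p), (Sim.refl _ _ _ q).append
          (ih _ _ _ hd (by omega) (by omega))⟩
      have : m = c' + 1 + (m - 1 - c') := by omega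
      conv_lhs => rw [this, wordPow_split hu]
      simp
    · obtain ⟨d', hd', hs⟩ := key d
      refine ⟨(wordPow u m ++ v ++ wordPow u (n - 1 - d')) ++ p, q ++ wordPow u d', ?_,
        (ih _ _ _ (by omega) (by omega) (by omega)).append (Sim.refl _ _ _ p),
          (Sim.refl _ _ _ q).append hs⟩
      have : n = (n - 1 - d') + 1 + d' := by omega
      conv_lhs => rw [this, wordPow_split hu]
      simp

/-- The words over a finite alphabet fall into finitely many classes at every rank. -/
theorem exists_finite_type (B : Type u) [Finite B] (k : ℕ) :
    ∃ (F : Type u) (_ : Finite F) (T : List B → F), ∀ u u', T u = T u' →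
      ∀ i w, (WSim k i u w ↔ WSim k i u' w) ∧ (WSim k i w u ↔ WSim k i w u') := by
  induction k with
  | zero => exact ⟨PUnit, inferInstance, fun _ => ⟨⟩, fun _ _ _ _ _ => by simp [WSim, Sim]⟩
  | succ k ih =>
    obtain ⟨F, _, T, hT⟩ := ih
    -- The type at rank `k + 1` records which letters occur between which pairs of types of rank
    -- `k`.
    let S : List B → Set (B × F × F) := fun u => {c | ∃ x y, u = x ++ c.1 :: y ∧ c.2 = (T x, T y)}
    have mem : ∀ {u u' x y : List B} {b : B}, S u = S u' → u = x ++ b :: y →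
        ∃ x' y', u' = x' ++ b :: y' ∧ T x = T x' ∧ T y = T y' := by
      intro u u' x y b h e
      have : (b, T x, T y) ∈ S u' := h ▸ ⟨x, y, e, rfl⟩
      obtain ⟨x', y', e', h'⟩ := this
      simp only [Prod.mk.injEq] at h'
      exact ⟨x', y', e', h'⟩
    have main : ∀ u u', S u = S u' → ∀ i w, (WSim (k + 1) i u w → WSim (k + 1) i u' w) ∧
        (WSim (k + 1) i w u → WSim (k + 1) i w u') := by
      intro u u' h i w
      cases i with
      | zero => simp [WSim, Sim]
      | succ i =>
        constructor
        · refine fun hs => ⟨by simp, fun x b y e => ?_, fun hi x b y e => ?_⟩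
          · obtain ⟨x₁, y₁, e₁, hx, hy⟩ := mem h.symm e
            obtain ⟨x', y', e', hx', hy'⟩ := hs.2.1 _ _ _ e₁
            exact ⟨x', y', e', ((hT _ _ hx _ _).1).2 hx', ((hT _ _ hy _ _).1).2 hy'⟩
          · obtain ⟨x', y', e', hx', hy'⟩ := hs.2.2 hi _ _ _ e
            obtain ⟨x₁, y₁, e₁, hx, hy⟩ := mem h e'
            exact ⟨x₁, y₁, e₁, ((hT _ _ hx _ _).2).1 hx', ((hT _ _ hy _ _).2).1 hy'⟩
        · refine fun hs => ⟨by simp, fun x b y e => ?_, fun hi x b y e => ?_⟩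
          · obtain ⟨x', y', e', hx', hy'⟩ := hs.2.1 _ _ _ e
            obtain ⟨x₁, y₁, e₁, hx, hy⟩ := mem h e'
            exact ⟨x₁, y₁, e₁, ((hT _ _ hx _ _).2).1 hx', ((hT _ _ hy _ _).2).1 hy'⟩
          · obtain ⟨x₁, y₁, e₁, hx, hy⟩ := mem h.symm e
            obtain ⟨x', y', e', hx', hy'⟩ := hs.2.2 hi _ _ _ e₁
            exact ⟨x', y', e', ((hT _ _ hx _ _).1).2 hx', ((hT _ _ hy _ _).1).2 hy'⟩
    exact ⟨Set (B × F × F), inferInstance, S, fun u u' h i w =>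
      ⟨⟨(main u u' h i w).1, (main u' u h.symm i w).1⟩,
        (main u u' h i w).2, (main u' u h.symm i w).2⟩⟩

end Simulation

-- The game preorder preserves formulas

section Soundness

variable {A : Type u} {n : ℕ}

/-- The formula `φ` holds in the word `w` for the positions `a`. -/
def Holds (w : List A) (φ : (wordLang A).BoundedFormula Empty n) (a : Fin n → Fin w.length) :
    Prop :=
  letI := wordStructure w
  φ.Realize default a

/-- The position denoted by a term: the signature is relational, so every term is a variable. -/
def termIndex : (wordLang A).Term (Empty ⊕ Fin n) → Fin n
  | .var (.inr j) => j
  | .func f _ => nomatch f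

theorem realize_eq_termIndex (w : List A) (a : Fin n → Fin w.length)
    (t : (wordLang A).Term (Empty ⊕ Fin n)) :
    letI := wordStructure w
    t.realize (Sum.elim default a) = a (termIndex t) := by
  rcases t with (t | t) | ⟨f, _⟩
  · exact t.elim
  · rfl
  · exact f.elim

theorem holds_equal (w : List A) (a : Fin n → Fin w.length)
    (s t : (wordLang A).Term (Empty ⊕ Fin n)) :
    Holds w (.equal s t) a ↔ a (termIndex s) = a (termIndex t) := by
  rw [← realize_eq_termIndex w a s, ← realize_eq_termIndex w a t]
  exact Iff.rfl

theorem holds_letter (w : List A) (a : Fin n → Fin w.length) (c : A)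
    (t : Fin 1 → (wordLang A).Term (Empty ⊕ Fin n)) :
    Holds w (.rel (WordRel.letter c) t) a ↔ w.get (a (termIndex (t 0))) = c := by
  rw [← realize_eq_termIndex w a (t 0)]
  exact Iff.rfl

theorem holds_lt (w : List A) (a : Fin n → Fin w.length)
    (t : Fin 2 → (wordLang A).Term (Empty ⊕ Fin n)) :
    Holds w (.rel WordRel.lt t) a ↔ a (termIndex (t 0)) < a (termIndex (t 1)) := by
  rw [← realize_eq_termIndex w a (t 0), ← realize_eq_termIndex w a (t 1)]
  exact Iff.rfl

/-- The word `w` with a record, at every position, of the variables that denote this position. -/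
def mark (w : List A) (a : Fin n → Fin w.length) : List (A × (Fin n → Bool)) :=
  List.ofFn fun p : Fin w.length => (w.get p, fun j => decide (a j = p))

theorem length_mark (w : List A) (a : Fin n → Fin w.length) : (mark w a).length = w.length := by
  simp [mark]

theorem getElem_mark (w : List A) (a : Fin n → Fin w.length) (p : ℕ) (hp : p < (mark w a).length) :
    (mark w a)[p] = (w[p]'(by simpa [length_mark] using hp),
      fun j => decide ((a j : ℕ) = p)) := by
  simp [mark, Fin.ext_iff]

/-- A letter is distinguished if it carries a variable. -/
def IsMarked (n : ℕ) (b : A × (Fin n → Bool)) : Bool := decide (∃ j, b.2 j = true)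

/-- Adds a variable that does not denote the position at hand. -/
def keepMark (b : A × (Fin n → Bool)) : A × (Fin (n + 1) → Bool) :=
  (b.1, Fin.snoc (α := fun _ => Bool) b.2 false)

/-- Adds a variable that denotes the position at hand. -/
def addMark (b : A × (Fin n → Bool)) : A × (Fin (n + 1) → Bool) :=
  (b.1, Fin.snoc (α := fun _ => Bool) b.2 true)

theorem isMarked_keepMark (b : A × (Fin n → Bool)) :
    IsMarked (n + 1) (keepMark b) = IsMarked n b := by
  have : (∃ j, Fin.snoc (α := fun _ => Bool) b.2 false j = true) ↔ ∃ j, b.2 j = true := by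
    constructor
    · rintro ⟨j, hj⟩
      induction j using Fin.lastCases with
      | last => simp at hj
      | cast j => exact ⟨j, by simpa using hj⟩
    · rintro ⟨j, hj⟩
      exact ⟨j.castSucc, by simpa using hj⟩
  simp only [IsMarked, keepMark, this]

theorem mark_snoc (w : List A) (a : Fin n → Fin w.length) (p : Fin w.length)
    {x y : List (A × (Fin n → Bool))} {b : A × (Fin n → Bool)} (h : mark w a = x ++ b :: y)
    (hx : x.length = p) :
    mark w (Fin.snoc (α := fun _ => Fin w.length) a p) =
      x.map keepMark ++ addMark b :: y.map keepMark := by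
  have hl : x.length + (y.length + 1) = w.length := by
    rw [← length_mark w a, h]; simp
  have key : ∀ q : Fin w.length, (mark w (Fin.snoc (α := fun _ => Fin w.length) a p))[(q : ℕ)]'(by
      rw [length_mark]; exact q.2) = if q = p then addMark ((mark w a)[(q : ℕ)]'(by
        rw [length_mark]; exact q.2)) else keepMark ((mark w a)[(q : ℕ)]'(by
        rw [length_mark]; exact q.2)) := by
    intro q
    rw [getElem_mark, getElem_mark]
    split_ifs with hq
    · refine Prod.ext rfl (funext fun j => ?_)
      refine Fin.lastCases ?_ (fun j => ?_) j <;> simp [addMark, hq]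
    · refine Prod.ext rfl (funext fun j => ?_)
      refine Fin.lastCases ?_ (fun j => ?_) j
      · simp only [keepMark, Fin.snoc_last, decide_eq_false_iff_not]
        exact fun h => hq (Fin.ext h.symm)
      · simp [keepMark]
  refine List.ext_getElem (by simp [length_mark]; omega) fun q h₁ h₂ => ?_
  rw [length_mark] at h₁
  rw [key ⟨q, h₁⟩]
  simp only [h, Fin.ext_iff]
  rcases lt_trichotomy q p with hq | hq | hq
  · rw [if_neg hq.ne, List.getElem_append_left (by omega),
      List.getElem_append_left (by simp; omega)]
    simp
  · subst hq
    simp [← hx]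
  · rw [if_neg hq.ne', List.getElem_append_right (by omega),
      List.getElem_append_right (by simp; omega), List.getElem_cons, List.getElem_cons,
      dif_neg (by omega), dif_neg (by simp; omega)]
    simp

/-- Equalities and letter predicates can be read off the marked letters alone, so equality of the
filtered words makes these atomic formulas agree. The predicate `P` covers both cases at once. -/
theorem exists_mem_filter_mark (w : List A) (a : Fin n → Fin w.length) (P : A → Prop) (j l : Fin n) :
    (∃ b ∈ (mark w a).filter (IsMarked n), b.2 j = true ∧ b.2 l = true ∧ P b.1) ↔
      a j = a l ∧ P (w.get (a j)) := by
  constructor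
  · rintro ⟨b, hb, hj, hl, hP⟩
    obtain ⟨p, hp, rfl⟩ := List.getElem_of_mem (List.mem_of_mem_filter hb)
    rw [getElem_mark] at hj hl hP
    simp only [decide_eq_true_eq] at hj hl
    refine ⟨Fin.ext (hj.trans hl.symm), ?_⟩
    subst hj
    exact hP
  · rintro ⟨h, hP⟩
    have hp : (a j : ℕ) < (mark w a).length := by rw [length_mark]; exact (a j).2
    refine ⟨(mark w a)[(a j : ℕ)], List.mem_filter.2 ⟨List.getElem_mem _, ?_⟩, ?_⟩
    · rw [getElem_mark]
      simp only [IsMarked, decide_eq_true_eq]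
      exact ⟨j, rfl⟩
    · rw [getElem_mark]
      simp only [decide_eq_true_eq]
      exact ⟨trivial, by rw [h], hP⟩

/-- The order of the chosen positions is likewise determined by the subsequence of marked letters.
-/
theorem exists_sublist_filter_mark (w : List A) (a : Fin n → Fin w.length) (j l : Fin n) :
    (∃ b c, [b, c].Sublist ((mark w a).filter (IsMarked n)) ∧ b.2 j = true ∧ c.2 l = true) ↔
      a j < a l := by
  constructor
  · rintro ⟨b, c, hs, hb, hc⟩
    obtain ⟨f, hf⟩ := List.sublist_iff_exists_fin_orderEmbedding_get_eq.1
      (hs.trans List.filter_sublist)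
    have h0 := hf ⟨0, by simp⟩
    have h1 := hf ⟨1, by simp⟩
    simp only [List.get_eq_getElem, List.getElem_cons_zero, List.getElem_cons_succ,
      getElem_mark] at h0 h1
    rw [h0] at hb
    rw [h1] at hc
    simp only [decide_eq_true_eq] at hb hc
    have : f ⟨0, by simp⟩ < f ⟨1, by simp⟩ := f.lt_iff_lt.2 (by simp)
    rw [Fin.lt_def] at this ⊢
    omega
  · intro h
    have hj : (a j : ℕ) < (mark w a).length := by rw [length_mark]; exact (a j).2
    have hl : (a l : ℕ) < (mark w a).length := by rw [length_mark]; exact (a l).2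
    refine ⟨(mark w a)[(a j : ℕ)], (mark w a)[(a l : ℕ)], ?_, ?_, ?_⟩
    · have hs : [(mark w a)[(a j : ℕ)], (mark w a)[(a l : ℕ)]].Sublist (mark w a) := by
        conv_rhs => rw [← List.take_append_drop (a l) (mark w a)]
        change ([_] ++ [_]).Sublist _
        refine List.Sublist.append ?_ ?_
        · rw [List.singleton_sublist, List.mem_take_iff_getElem]
          exact ⟨a j, by rw [Fin.lt_def] at h; omega, rfl⟩
        · rw [List.singleton_sublist, List.drop_eq_getElem_cons hl]
          exact List.mem_cons_self
      have := hs.filter (IsMarked n)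
      rwa [List.filter_eq_self.2] at this
      intro b hb
      simp only [List.mem_cons, List.not_mem_nil, or_false] at hb
      rcases hb with rfl | rfl <;> rw [getElem_mark] <;>
        simp only [IsMarked, decide_eq_true_eq]
      · exact ⟨j, rfl⟩
      · exact ⟨l, rfl⟩
    · rw [getElem_mark]; simp
    · rw [getElem_mark]; simp

theorem exists_mark_split (w : List A) (a : Fin n → Fin w.length) (p : Fin w.length) :
    ∃ x b y, mark w a = x ++ b :: y ∧ x.length = (p : ℕ) := by
  have hp : (p : ℕ) < (mark w a).length := by rw [length_mark]; exact p.2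
  refine ⟨(mark w a).take p, (mark w a)[(p : ℕ)], (mark w a).drop (p + 1), ?_, ?_⟩
  · rw [← List.drop_eq_getElem_cons hp, List.take_append_drop]
  · rw [List.length_take]; omega

theorem Sim.mark_snoc {k i : ℕ} {w w' : List A} {a : Fin n → Fin w.length}
    {a' : Fin n → Fin w'.length} {p : Fin w.length} {p' : Fin w'.length}
    {x y x' y' : List (A × (Fin n → Bool))} {b : A × (Fin n → Bool)}
    (h : mark w a = x ++ b :: y) (hp : x.length = p)
    (h' : mark w' a' = x' ++ b :: y') (hp' : x'.length = p')
    (hx : Sim (IsMarked n) k i x x') (hy : Sim (IsMarked n) k i y y') :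
    Sim (IsMarked (n + 1)) k i (mark w (Fin.snoc (α := fun _ => Fin w.length) a p))
      (mark w' (Fin.snoc (α := fun _ => Fin w'.length) a' p')) := by
  rw [WordLogic.mark_snoc w a p h hp, WordLogic.mark_snoc w' a' p' h' hp']
  exact (hx.map keepMark isMarked_keepMark).append
    ((Sim.refl _ k i [addMark b]).append (hy.map keepMark isMarked_keepMark))

/-- The two directions need each other: an implication dualizes its premise, and a universal
quantifier in a `Σ` formula moves the game to the level below with the words exchanged. -/
theorem Sim.holds (φ : (wordLang A).BoundedFormula Empty n) :
    ∀ (k i : ℕ) (w w' : List A) (a : Fin n → Fin w.length) (a' : Fin n → Fin w'.length),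
      Sim (IsMarked n) k i (mark w a) (mark w' a') → quantifierRank φ ≤ k →
      (sigmaLevel φ ≤ i → Holds w φ a → Holds w' φ a') ∧
      (piLevel φ ≤ i → Holds w' φ a' → Holds w φ a) := by
  induction φ with
  | falsum => exact fun k i w w' a a' _ _ => ⟨fun _ h => h, fun _ h => h⟩
  | equal s t =>
    intro k i w w' a a' h _
    have : Holds w (.equal s t) a ↔ Holds w' (.equal s t) a' := by
      rw [holds_equal, holds_equal, ← and_true (_ = _), ← and_true (a' _ = _),
        ← exists_mem_filter_mark w a (fun _ => True), ← exists_mem_filter_mark w' a' (fun _ => True),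
        h.filter_eq]
    exact ⟨fun _ => this.1, fun _ => this.2⟩
  | rel R t =>
    intro k i w w' a a' h _
    have : Holds w (.rel R t) a ↔ Holds w' (.rel R t) a' := by
      rcases R with c | _
      · have key := fun (w : List A) a => exists_mem_filter_mark (n := _) w a (· = c)
          (termIndex (t 0)) (termIndex (t 0))
        rw [holds_letter, holds_letter, ← (key w a).trans (and_iff_right rfl),
          ← (key w' a').trans (and_iff_right rfl), h.filter_eq]
      · rw [holds_lt, holds_lt, ← exists_sublist_filter_mark, ← exists_sublist_filter_mark,
          h.filter_eq]
    exact ⟨fun _ => this.1, fun _ => this.2⟩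
  | imp φ ψ ihφ ihψ =>
    intro k i w w' a a' h hr
    simp only [quantifierRank, max_le_iff] at hr
    obtain ⟨h1, h2⟩ := ihφ k i w w' a a' h hr.1
    obtain ⟨h3, h4⟩ := ihψ k i w w' a a' h hr.2
    constructor
    · intro hl hw hφ
      simp only [sigmaLevel, max_le_iff] at hl
      exact h3 hl.2 (hw (h2 hl.1 hφ))
    · intro hl hw hφ
      simp only [piLevel, max_le_iff] at hl
      exact h4 hl.2 (hw (h1 hl.1 hφ))
  | @all m φ ih =>
    intro k i w w' a a' h hr
    simp only [quantifierRank] at hr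
    obtain ⟨k, rfl⟩ : ∃ l, k = l + 1 := ⟨k - 1, by omega⟩
    have hr' : quantifierRank φ ≤ k := by omega
    constructor
    · intro hl hw p'
      simp only [sigmaLevel] at hl
      obtain ⟨i, rfl⟩ : ∃ j, i = j + 1 := ⟨i - 1, by omega⟩
      obtain ⟨x', b, y', e', hp'⟩ := exists_mark_split w' a' p'
      -- A universal formula has `sigmaLevel` at least 2, which is what makes the backward clause of
      -- the game available.
      obtain ⟨x, y, e, hx, hy⟩ := h.2.2 (by omega) _ _ _ e'
      have hlt : x.length < w.length := by rw [← length_mark w a, e]; simp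
      exact (ih k i w' w _ _ (Sim.mark_snoc e' hp' e (p' := ⟨x.length, hlt⟩) rfl hx hy) hr').2
        (by omega) (hw ⟨x.length, hlt⟩)
    · intro hl hw p
      simp only [piLevel] at hl
      obtain ⟨i, rfl⟩ : ∃ j, i = j + 1 := ⟨i - 1, by omega⟩
      obtain ⟨x, b, y, e, hp⟩ := exists_mark_split w a p
      obtain ⟨x', y', e', hx, hy⟩ := h.2.1 _ _ _ e
      have hlt : x'.length < w'.length := by rw [← length_mark w' a', e']; simp
      exact (ih k (i + 1) w w' _ _ (Sim.mark_snoc e hp e' (p' := ⟨x'.length, hlt⟩) rfl hx hy)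
        hr').2 (by omega) (hw ⟨x'.length, hlt⟩)

theorem WSim.sigmaLE {k i : ℕ} {w w' : List A} (h : WSim k i w w') : SigmaLE k i w w' := by
  intro φ hi hk hw
  have hm : ∀ w : List A, mark w (default : Fin 0 → Fin w.length) =
      w.map fun c => (c, fun _ => false) := by
    intro w
    refine List.ext_getElem (by simp [length_mark]) fun q h₁ h₂ => ?_
    rw [getElem_mark]
    simpa using Subsingleton.elim _ _
  have h' : Sim (IsMarked 0) k i (mark w default) (mark w' default) := by
    rw [hm, hm]
    exact h.map _ (by simp [IsMarked])
  exact (Sim.holds φ k i w w' _ _ h' hk).1 hi hw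

end Soundness

-- Characteristic formulas and definability through the game

section Definability

variable {A : Type u} {n : ℕ} {i k : ℕ}

theorem piLevel_sigmaLevel_le (φ : (wordLang A).BoundedFormula Empty n) :
    piLevel φ ≤ sigmaLevel φ + 1 ∧ sigmaLevel φ ≤ piLevel φ + 1 := by
  induction φ with
  | falsum => simp [piLevel, sigmaLevel]
  | equal => simp [piLevel, sigmaLevel]
  | rel => simp [piLevel, sigmaLevel]
  | imp φ ψ ih ih' => simp only [piLevel, sigmaLevel]; omega
  | all φ ih => simp only [piLevel, sigmaLevel]; omega

/-- The property `P` of words with `n` positions is expressed by a `Σ_i` formula of quantifier rank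
at most `k`. -/
def SigmaPred (i k : ℕ) (P : ∀ w : List A, (Fin n → Fin w.length) → Prop) : Prop :=
  ∃ φ : (wordLang A).BoundedFormula Empty n,
    sigmaLevel φ ≤ i ∧ quantifierRank φ ≤ k ∧ ∀ w a, Holds w φ a ↔ P w a

/-- The property `P` of words with `n` positions is expressed by a `Π_i` formula of quantifier rank
at most `k`. -/
def PiPred (i k : ℕ) (P : ∀ w : List A, (Fin n → Fin w.length) → Prop) : Prop :=
  ∃ φ : (wordLang A).BoundedFormula Empty n,
    piLevel φ ≤ i ∧ quantifierRank φ ≤ k ∧ ∀ w a, Holds w φ a ↔ P w a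

variable {P Q : ∀ w : List A, (Fin n → Fin w.length) → Prop}

theorem SigmaPred.congr (h : SigmaPred i k P) (hPQ : ∀ w a, P w a ↔ Q w a) : SigmaPred i k Q := by
  obtain ⟨φ, h1, h2, h3⟩ := h
  exact ⟨φ, h1, h2, fun w a => (h3 w a).trans (hPQ w a)⟩

theorem PiPred.congr (h : PiPred i k P) (hPQ : ∀ w a, P w a ↔ Q w a) : PiPred i k Q := by
  obtain ⟨φ, h1, h2, h3⟩ := h
  exact ⟨φ, h1, h2, fun w a => (h3 w a).trans (hPQ w a)⟩

theorem SigmaPred.toPi (h : SigmaPred i k P) : PiPred (i + 1) k P := by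
  obtain ⟨φ, h1, h2, h3⟩ := h
  exact ⟨φ, (piLevel_sigmaLevel_le φ).1.trans (by omega), h2, h3⟩

theorem PiPred.toSigma (h : PiPred i k P) : SigmaPred (i + 1) k P := by
  obtain ⟨φ, h1, h2, h3⟩ := h
  exact ⟨φ, (piLevel_sigmaLevel_le φ).2.trans (by omega), h2, h3⟩

theorem SigmaPred.not (h : SigmaPred i k P) : PiPred i k fun w a => ¬ P w a := by
  obtain ⟨φ, h1, h2, h3⟩ := h
  exact ⟨φ.imp .falsum, by simpa [piLevel] using h1, by simpa [quantifierRank] using h2,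
    fun w a => not_congr (h3 w a)⟩

theorem PiPred.not (h : PiPred i k P) : SigmaPred i k fun w a => ¬ P w a := by
  obtain ⟨φ, h1, h2, h3⟩ := h
  exact ⟨φ.imp .falsum, by simpa [sigmaLevel] using h1, by simpa [quantifierRank] using h2,
    fun w a => not_congr (h3 w a)⟩

theorem SigmaPred.or (h : SigmaPred i k P) (h' : SigmaPred i k Q) :
    SigmaPred i k fun w a => P w a ∨ Q w a := by
  obtain ⟨φ, h1, h2, h3⟩ := h
  obtain ⟨ψ, h1', h2', h3'⟩ := h'
  refine ⟨(φ.imp .falsum).imp ψ, ?_, ?_, fun w a => ?_⟩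
  · simp only [sigmaLevel, piLevel]; omega
  · simp only [quantifierRank]; omega
  · beta_reduce
    rw [← h3, ← h3', or_iff_not_imp_left]
    exact Iff.rfl

theorem PiPred.or (h : PiPred i k P) (h' : PiPred i k Q) :
    PiPred i k fun w a => P w a ∨ Q w a := by
  obtain ⟨φ, h1, h2, h3⟩ := h
  obtain ⟨ψ, h1', h2', h3'⟩ := h'
  refine ⟨(φ.imp .falsum).imp ψ, ?_, ?_, fun w a => ?_⟩
  · simp only [sigmaLevel, piLevel]; omega
  · simp only [quantifierRank]; omega
  · beta_reduce
    rw [← h3, ← h3', or_iff_not_imp_left]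
    exact Iff.rfl

theorem SigmaPred.and (h : SigmaPred i k P) (h' : SigmaPred i k Q) :
    SigmaPred i k fun w a => P w a ∧ Q w a :=
  (h.not.or h'.not).not.congr fun _ _ => by rw [not_or, not_not, not_not]

theorem PiPred.and (h : PiPred i k P) (h' : PiPred i k Q) :
    PiPred i k fun w a => P w a ∧ Q w a :=
  (h.not.or h'.not).not.congr fun _ _ => by rw [not_or, not_not, not_not]

theorem sigmaPred_const (i k : ℕ) (c : Prop) :
    SigmaPred i k fun (w : List A) (_ : Fin n → Fin w.length) => c := by
  by_cases hc : c
  · exact ⟨.imp .falsum .falsum, by simp [sigmaLevel, piLevel], by simp [quantifierRank],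
      fun w a => iff_of_true (fun h => h) hc⟩
  · exact ⟨.falsum, by simp [sigmaLevel], by simp [quantifierRank],
      fun w a => iff_of_false (fun h => h) hc⟩

theorem piPred_const (i k : ℕ) (c : Prop) :
    PiPred i k fun (w : List A) (_ : Fin n → Fin w.length) => c :=
  (sigmaPred_const i k (¬ c)).not.congr fun _ _ => not_not

theorem SigmaPred.finite_exists {ι : Type*} [Finite ι]
    {P : ι → ∀ w : List A, (Fin n → Fin w.length) → Prop} (h : ∀ j, SigmaPred i k (P j)) :
    SigmaPred i k fun w a => ∃ j, P j w a := by
  classical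
  have := Fintype.ofFinite ι
  have key : ∀ s : Finset ι, SigmaPred i k fun w a => ∃ j ∈ s, P j w a := by
    intro s
    induction s using Finset.induction_on with
    | empty => exact (sigmaPred_const i k False).congr (by simp)
    | insert j s _ ih => exact ((h j).or ih).congr (by simp)
  exact (key Finset.univ).congr (by simp)

theorem SigmaPred.finite_forall {ι : Type*} [Finite ι]
    {P : ι → ∀ w : List A, (Fin n → Fin w.length) → Prop} (h : ∀ j, SigmaPred i k (P j)) :
    SigmaPred i k fun w a => ∀ j, P j w a := by
  classical
  have := Fintype.ofFinite ι
  have key : ∀ s : Finset ι, SigmaPred i k fun w a => ∀ j ∈ s, P j w a := by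
    intro s
    induction s using Finset.induction_on with
    | empty => exact (sigmaPred_const i k True).congr (by simp)
    | insert j s _ ih => exact ((h j).and ih).congr (by simp)
  exact (key Finset.univ).congr (by simp)

theorem PiPred.finite_exists {ι : Type*} [Finite ι]
    {P : ι → ∀ w : List A, (Fin n → Fin w.length) → Prop} (h : ∀ j, PiPred i k (P j)) :
    PiPred i k fun w a => ∃ j, P j w a :=
  (SigmaPred.finite_forall fun j => (h j).not).not.congr (by simp)

theorem PiPred.all {P : ∀ w : List A, (Fin (n + 1) → Fin w.length) → Prop}
    (h : PiPred (i + 1) k P) : PiPred (i + 1) (k + 1)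
      fun w (a : Fin n → Fin w.length) => ∀ p, P w (Fin.snoc (α := fun _ => Fin w.length) a p) := by
  obtain ⟨φ, h1, h2, h3⟩ := h
  refine ⟨φ.all, ?_, ?_, fun w a => forall_congr' fun p => h3 w _⟩
  · simp only [piLevel]; omega
  · simp only [quantifierRank]; omega

theorem SigmaPred.ex {P : ∀ w : List A, (Fin (n + 1) → Fin w.length) → Prop}
    (h : SigmaPred (i + 1) k P) : SigmaPred (i + 1) (k + 1)
      fun w (a : Fin n → Fin w.length) => ∃ p, P w (Fin.snoc (α := fun _ => Fin w.length) a p) :=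
  h.not.all.not.congr fun _ _ => by simp

theorem sigmaPred_lt (i k : ℕ) (j l : Fin n) :
    SigmaPred i k fun (w : List A) (a : Fin n → Fin w.length) => a j < a l :=
  ⟨.rel WordRel.lt ![.var (.inr j), .var (.inr l)], by simp [sigmaLevel], by simp [quantifierRank],
    fun w a => holds_lt w a _⟩

theorem sigmaPred_letter (i k : ℕ) (j : Fin n) (c : A) :
    SigmaPred i k fun (w : List A) (a : Fin n → Fin w.length) => w.get (a j) = c :=
  ⟨.rel (WordRel.letter c) fun _ => .var (.inr j), by simp [sigmaLevel], by simp [quantifierRank],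
    fun w a => holds_letter w a c _⟩

theorem piPred_letter (i k : ℕ) (j : Fin n) (c : A) :
    PiPred i k fun (w : List A) (a : Fin n → Fin w.length) => w.get (a j) = c :=
  ⟨.rel (WordRel.letter c) fun _ => .var (.inr j), by simp [piLevel], by simp [quantifierRank],
    fun w a => holds_letter w a c _⟩

theorem drop_take_eq_append_cons_iff (w : List A) (l h : ℕ) (x : List A) (b : A) (y : List A) :
    (w.take h).drop l = x ++ b :: y ↔ ∃ q : Fin w.length, (l ≤ q ∧ q < h) ∧
      x = (w.take q).drop l ∧ b = w.get q ∧ y = (w.take h).drop (q + 1) := by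
  constructor
  · intro e
    have hlen := congrArg List.length e
    simp only [List.length_drop, List.length_take, List.length_append, List.length_cons] at hlen
    refine ⟨⟨l + x.length, by omega⟩, ⟨by simp, by simp; omega⟩, ?_, ?_, ?_⟩
    · have := congrArg (List.take x.length) e
      rw [List.take_left, List.take_drop, List.take_take] at this
      have hm : min (l + x.length) h = l + x.length := by omega
      rw [hm] at this
      exact this.symm
    · have : ((w.take h).drop l)[x.length]? = some b := by rw [e]; simp
      rw [List.getElem?_drop, List.getElem?_take_of_lt (by omega),
        List.getElem?_eq_getElem (by omega)] at this
      simpa using this.symm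
    · have := congrArg (List.drop (x.length + 1)) e
      rw [List.drop_drop] at this
      rw [← add_assoc] at this
      rw [this]
      simp
  · rintro ⟨q, ⟨h1, h2⟩, rfl, rfl, rfl⟩
    have hq : (q : ℕ) < (w.take h).length := by rw [List.length_take]; omega
    conv_lhs => rw [← List.take_append_drop q (w.take h), List.drop_eq_getElem_cons hq,
      List.take_take, min_eq_left h2.le]
    rw [List.drop_append_of_le_length (by rw [List.length_take]; omega)]
    simp

theorem eq_append_cons_iff (u : List A) (x : List A) (b : A) (y : List A) :
    u = x ++ b :: y ↔ ∃ p : Fin u.length, x = u.take p ∧ b = u.get p ∧ y = u.drop (p + 1) := by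
  have := drop_take_eq_append_cons_iff u 0 u.length x b y
  simpa using this

/-- The factor of `w` strictly between the positions `l` and `r`, where `none` stands for an end of
the word. -/
def seg (w : List A) (a : Fin n → Fin w.length) (l r : Option (Fin n)) : List A :=
  (w.take (r.elim w.length fun j => a j)).drop (l.elim 0 fun j => (a j : ℕ) + 1)

/-- The last position lies strictly between the positions `l` and `r`. -/
def InSeg (l r : Option (Fin n)) (w : List A) (a : Fin (n + 1) → Fin w.length) : Prop :=
  (∀ j, l = some j → a j.castSucc < a (Fin.last n)) ∧
    (∀ j, r = some j → a (Fin.last n) < a j.castSucc)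

theorem seg_eq_append_cons_iff (w : List A) (a : Fin n → Fin w.length) (l r : Option (Fin n))
    (x : List A) (b : A) (y : List A) :
    seg w a l r = x ++ b :: y ↔ ∃ q : Fin w.length,
      InSeg l r w (Fin.snoc (α := fun _ => Fin w.length) a q) ∧
      x = seg w (Fin.snoc (α := fun _ => Fin w.length) a q) (l.map Fin.castSucc)
        (some (Fin.last n)) ∧
      b = w.get q ∧
      y = seg w (Fin.snoc (α := fun _ => Fin w.length) a q) (some (Fin.last n))
        (r.map Fin.castSucc) := by
  unfold seg
  rw [drop_take_eq_append_cons_iff]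
  refine exists_congr fun q => and_congr ?_ ?_
  · refine and_congr ?_ ?_
    · cases l <;> simp
    · cases r <;> simp
  · cases l <;> cases r <;> simp

theorem sigmaPred_inSeg (i k : ℕ) (l r : Option (Fin n)) : SigmaPred i k (InSeg (A := A) l r) := by
  refine SigmaPred.and ?_ ?_
  · cases l with
    | none => exact (sigmaPred_const i k True).congr (by simp)
    | some j => exact (sigmaPred_lt i k j.castSucc (Fin.last n)).congr (by simp)
  · cases r with
    | none => exact (sigmaPred_const i k True).congr (by simp)
    | some j => exact (sigmaPred_lt i k (Fin.last n) j.castSucc).congr (by simp)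

/-- Since `u` is a fixed word, its splittings form a finite conjunction; only the answering position
in `w` costs a quantifier. -/
theorem SigmaPred.forall_split {l r : Option (Fin n)} {u : List A}
    {R : List A → List A → Prop}
    (h : ∀ (v : List A) l r, SigmaPred (n := n + 1) (i + 1) k fun w a => R v (seg w a l r)) :
    SigmaPred (n := n) (i + 1) (k + 1) fun w a => ∀ x b y, u = x ++ b :: y →
      ∃ x' y', seg w a l r = x' ++ b :: y' ∧ R x x' ∧ R y y' := by
  have key : ∀ p : Fin u.length, SigmaPred (n := n) (i + 1) (k + 1) fun w a => ∃ q,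
      (fun w a => InSeg l r w a ∧ w.get (a (Fin.last n)) = u.get p ∧
        R (u.take p) (seg w a (l.map Fin.castSucc) (some (Fin.last n))) ∧
        R (u.drop (p + 1)) (seg w a (some (Fin.last n)) (r.map Fin.castSucc))) w
        (Fin.snoc (α := fun _ => Fin w.length) a q) :=
    fun p => SigmaPred.ex ((sigmaPred_inSeg _ _ l r).and ((sigmaPred_letter _ _ _ _).and
      ((h _ _ _).and (h _ _ _))))
  refine (SigmaPred.finite_forall key).congr fun w a => ?_
  simp only [Fin.snoc_last]
  constructor
  · intro H x b y e
    obtain ⟨p, rfl, rfl, rfl⟩ := (eq_append_cons_iff u x b y).1 e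
    obtain ⟨q, h1, h2, h3, h4⟩ := H p
    exact ⟨_, _, (seg_eq_append_cons_iff w a l r _ _ _).2 ⟨q, h1, rfl, h2.symm, rfl⟩, h3, h4⟩
  · intro H p
    obtain ⟨x', y', e, hx, hy⟩ := H _ _ _ ((eq_append_cons_iff u _ _ _).2 ⟨p, rfl, rfl, rfl⟩)
    obtain ⟨q, h1, rfl, h2, rfl⟩ := (seg_eq_append_cons_iff w a l r _ _ _).1 e
    exact ⟨q, h1, h2.symm, hx, hy⟩

theorem PiPred.forall_split {l r : Option (Fin n)} {u : List A}
    {R : List A → List A → Prop}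
    (h : ∀ (v : List A) l r, PiPred (n := n + 1) (i + 1) k fun w a => R (seg w a l r) v) :
    PiPred (n := n) (i + 1) (k + 1) fun w a => ∀ x b y, seg w a l r = x ++ b :: y →
      ∃ x' y', u = x' ++ b :: y' ∧ R x x' ∧ R y y' := by
  have key : PiPred (n := n) (i + 1) (k + 1) fun w a => ∀ q,
      (fun w a => ¬ InSeg l r w a ∨ ∃ p : Fin u.length, w.get (a (Fin.last n)) = u.get p ∧
        R (seg w a (l.map Fin.castSucc) (some (Fin.last n))) (u.take p) ∧
        R (seg w a (some (Fin.last n)) (r.map Fin.castSucc)) (u.drop (p + 1))) w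
        (Fin.snoc (α := fun _ => Fin w.length) a q) :=
    PiPred.all ((sigmaPred_inSeg _ _ l r).not.or (PiPred.finite_exists fun p =>
      (piPred_letter _ _ _ _).and ((h _ _ _).and (h _ _ _))))
  refine key.congr fun w a => ?_
  simp only [Fin.snoc_last, ← imp_iff_not_or]
  constructor
  · intro H x b y e
    obtain ⟨q, h1, rfl, rfl, rfl⟩ := (seg_eq_append_cons_iff w a l r _ _ _).1 e
    obtain ⟨p, h2, h3, h4⟩ := H q h1
    exact ⟨_, _, (eq_append_cons_iff u _ _ _).2 ⟨p, rfl, h2, rfl⟩, h3, h4⟩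
  · intro H q hq
    obtain ⟨x', y', e, hx, hy⟩ := H _ _ _ ((seg_eq_append_cons_iff w a l r _ _ _).2
      ⟨q, hq, rfl, rfl, rfl⟩)
    obtain ⟨p, rfl, h2, rfl⟩ := (eq_append_cons_iff u _ _ _).1 e
    exact ⟨p, h2, hx, hy⟩

theorem wSim_succ_iff {w w' : List A} : WSim (k + 1) (i + 1) w w' ↔
    (∀ x b y, w = x ++ b :: y →
        ∃ x' y', w' = x' ++ b :: y' ∧ WSim k (i + 1) x x' ∧ WSim k (i + 1) y y') ∧
      (0 < i → ∀ x' b y', w' = x' ++ b :: y' →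
        ∃ x y, w = x ++ b :: y ∧ WSim k i x' x ∧ WSim k i y' y) := by
  simp [WSim, Sim]

/-- The recursion of the game is transcribed into formulas. Its subgames are played on factors
between positions already quantified, hence the segments; the `Σ` and `Π` statements are proved
together because the backward clause of one is the forward clause of the other, one level lower. -/
theorem pred_wSim_seg (k : ℕ) : ∀ (i n : ℕ) (l r : Option (Fin n)) (u : List A),
    SigmaPred i k (fun w a => WSim k i u (seg w a l r)) ∧
      PiPred i k (fun w a => WSim k i (seg w a l r) u) := by
  induction k with
  | zero =>
    intro i n l r u
    exact ⟨(sigmaPred_const _ _ True).congr (by simp [WSim, Sim]),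
      (piPred_const _ _ True).congr (by simp [WSim, Sim])⟩
  | succ k ih =>
    intro i n l r u
    cases i with
    | zero =>
      exact ⟨(sigmaPred_const _ _ True).congr (by simp [WSim, Sim]),
        (piPred_const _ _ True).congr (by simp [WSim, Sim])⟩
    | succ i =>
      simp only [wSim_succ_iff]
      have hs : SigmaPred (i + 1) (k + 1) _ := SigmaPred.forall_split (n := n) (l := l) (r := r)
        (u := u) fun v l r => (ih (i + 1) (n + 1) l r v).1
      have hp : PiPred (i + 1) (k + 1) _ := PiPred.forall_split (n := n) (l := l) (r := r)
        (u := u) fun v l r => (ih (i + 1) (n + 1) l r v).2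
      -- At level 1 there is no backward clause.
      cases i with
      | zero => exact ⟨hs.congr (by simp), hp.congr (by simp)⟩
      | succ i =>
        have hs' : SigmaPred (i + 1) (k + 1) _ := SigmaPred.forall_split (n := n) (l := l) (r := r)
          (u := u) fun v l r => (ih (i + 1) (n + 1) l r v).1
        have hp' : PiPred (i + 1) (k + 1) _ := PiPred.forall_split (n := n) (l := l) (r := r)
          (u := u) fun v l r => (ih (i + 1) (n + 1) l r v).2
        exact ⟨(hs.and hp'.toSigma).congr (by simp), (hp.and hs'.toPi).congr (by simp)⟩

theorem sigmaPred_wSim (k i : ℕ) (u : List A) :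
    SigmaPred (n := 0) i k (fun w _ => WSim k i u w) :=
  (pred_wSim_seg k i 0 none none u).1.congr fun w a => by simp [seg]

theorem SigmaLE.wSim {w w' : List A} (h : SigmaLE k i w w') : WSim k i w w' := by
  obtain ⟨φ, h1, h2, h3⟩ := sigmaPred_wSim k i w
  exact (h3 w' default).1 (h φ h1 h2 ((h3 w default).2 (Sim.refl _ _ _ _)))

/-- A language closed upwards at rank `k` is the union of the up-sets of its words. There are
finitely many of these as the alphabet is finite, so a finite disjunction of characteristic
sentences defines it. -/
theorem sigmaDefinable_iff [Finite A] {L : Language A} :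
    SigmaDefinable i L ↔ ∃ k, ∀ w w', WSim k i w w' → w ∈ L → w' ∈ L := by
  constructor
  · rintro ⟨φ, hi, hφ⟩
    exact ⟨quantifierRank φ, fun w w' h hw =>
      (hφ w').2 (h.sigmaLE φ hi le_rfl ((hφ w).1 hw))⟩
  · rintro ⟨k, hk⟩
    obtain ⟨F, _, T, hT⟩ := exists_finite_type A k
    have key : ∀ f : F, SigmaPred (n := 0) i k
        (fun w _ => ∃ u : List A, u ∈ L ∧ T u = f ∧ WSim k i u w) := by
      intro f
      by_cases hf : ∃ u, u ∈ L ∧ T u = f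
      · obtain ⟨u, hu, rfl⟩ := hf
        refine (sigmaPred_wSim k i u).congr fun w a => ⟨fun h => ⟨u, hu, rfl, h⟩, ?_⟩
        rintro ⟨v, _, hv, h⟩
        exact ((hT _ _ hv i w).1).1 h
      · refine (sigmaPred_const i k False).congr fun w a => iff_of_false id ?_
        rintro ⟨u, hu, hv, _⟩
        exact hf ⟨u, hu, hv⟩
    obtain ⟨φ, h1, _, h3⟩ := SigmaPred.finite_exists key
    refine ⟨φ, h1, fun w => ⟨fun hw => (h3 w default).2 ⟨T w, w, hw, rfl, Sim.refl _ _ _ _⟩,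
      fun hw => ?_⟩⟩
    obtain ⟨_, u, hu, _, h⟩ := (h3 w default).1 hw
    exact hk _ _ h hu

theorem piDefinable_iff_compl {L : Language A} : PiDefinable i L ↔ SigmaDefinable i Lᶜ := by
  constructor
  · rintro ⟨φ, hi, hφ⟩
    exact ⟨φ.imp .falsum, by simpa [IsSigma, IsPi, sigmaLevel] using hi, fun w => not_congr (hφ w)⟩
  · rintro ⟨φ, hi, hφ⟩
    refine ⟨φ.imp .falsum, by simpa [IsSigma, IsPi, piLevel] using hi, fun w => ?_⟩
    exact (not_not (a := w ∈ L)).symm.trans (not_congr (hφ w))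

theorem piDefinable_iff [Finite A] {L : Language A} :
    PiDefinable i L ↔ ∃ k, ∀ w w', WSim k i w w' → w' ∈ L → w ∈ L := by
  rw [piDefinable_iff_compl, sigmaDefinable_iff]
  exact exists_congr fun k => forall_congr' fun w => forall_congr' fun w' =>
    imp_congr_right fun _ => not_imp_not

end Definability

-- Green's relations and stability

section Ideals

variable {M : Type v} [Monoid M]

/-- The two-sided ideal generated by an element. -/
def twoSided (x : M) : Set M := {z | ∃ a b, z = a * x * b}

/-- The left ideal generated by an element. -/
def leftIdeal (x : M) : Set M := {z | ∃ a, z = a * x}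

/-- The right ideal generated by an element. -/
def rightIdeal (x : M) : Set M := {z | ∃ a, z = x * a}

theorem twoSided_subset {x y a b : M} (h : y = a * x * b) : twoSided y ⊆ twoSided x := by
  rintro _ ⟨c, d, rfl⟩
  exact ⟨c * a, b * d, by simp only [h, mul_assoc]⟩

theorem mem_twoSided_self (x : M) : x ∈ twoSided x := ⟨1, 1, by simp⟩

theorem mem_leftIdeal_self (x : M) : x ∈ leftIdeal x := ⟨1, by simp⟩

theorem mem_rightIdeal_self (x : M) : x ∈ rightIdeal x := ⟨1, by simp⟩

theorem leftIdeal_mul_subset (a x : M) : leftIdeal (a * x) ⊆ leftIdeal x := by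
  rintro _ ⟨c, rfl⟩
  exact ⟨c * a, by rw [mul_assoc]⟩

theorem rightIdeal_mul_subset (a x : M) : rightIdeal (x * a) ⊆ rightIdeal x := by
  rintro _ ⟨c, rfl⟩
  exact ⟨a * c, by rw [mul_assoc]⟩

variable {N : ℕ}

theorem eq_pow_mul_mul_pow {x a b : M} (h : x = a * x * b) (n : ℕ) : x = a ^ n * x * b ^ n := by
  induction n with
  | zero => simp
  | succ n ih =>
    rw [pow_succ, pow_succ']
    calc x = a ^ n * x * b ^ n := ih
      _ = a ^ n * (a * x * b) * b ^ n := by rw [← h]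
      _ = _ := by simp only [mul_assoc]

/-- This is stability: from `x = c * a * x * d`, iteration shows that the idempotent `(c * a) ^ N`
fixes `x` on the left, which recovers `x` as a left multiple of `a * x`. -/
theorem leftIdeal_mul_eq (hN : 1 ≤ N) (hid : ∀ s : M, IsIdempotentElem (s ^ N)) {a x : M}
    (h : x ∈ twoSided (a * x)) : leftIdeal (a * x) = leftIdeal x := by
  refine (leftIdeal_mul_subset a x).antisymm ?_
  obtain ⟨c, d, hx⟩ := h
  have hx' := eq_pow_mul_mul_pow (a := c * a) (b := d) (by simpa only [mul_assoc] using hx) N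
  have e : (c * a) ^ N * x = x := by
    conv_lhs => rw [hx', ← mul_assoc, ← mul_assoc, (hid (c * a)).eq]
    exact hx'.symm
  obtain ⟨m, rfl⟩ : ∃ m, N = m + 1 := ⟨N - 1, by omega⟩
  have : x = ((c * a) ^ m * c) * (a * x) := by
    conv_lhs => rw [← e, pow_succ]
    simp only [mul_assoc]
  rintro _ ⟨z, rfl⟩
  exact ⟨z * ((c * a) ^ m * c), by rw [mul_assoc, ← this]⟩

theorem rightIdeal_mul_eq (hN : 1 ≤ N) (hid : ∀ s : M, IsIdempotentElem (s ^ N)) {a x : M}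
    (h : x ∈ twoSided (x * a)) : rightIdeal (x * a) = rightIdeal x := by
  refine (rightIdeal_mul_subset a x).antisymm ?_
  obtain ⟨c, d, hx⟩ := h
  have hx' := eq_pow_mul_mul_pow (a := c) (b := a * d) (by simpa only [mul_assoc] using hx) N
  have e : x * (a * d) ^ N = x := by
    conv_lhs => rw [hx', mul_assoc, (hid (a * d)).eq]
    exact hx'.symm
  obtain ⟨m, rfl⟩ : ∃ m, N = m + 1 := ⟨N - 1, by omega⟩
  have : x = (x * a) * (d * (a * d) ^ m) := by
    conv_lhs => rw [← e, pow_succ']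
    simp only [mul_assoc]
  rintro _ ⟨z, rfl⟩
  exact ⟨(d * (a * d) ^ m) * z, by rw [← mul_assoc, ← this]⟩

/-- If the last factors of `p` and `s`, and the first factors of `s` and `q`, agree up to Green's
relations inside a `J`-class that contains `p * s * q`, then `s` acts as an identity between `p`
and `q`, provided that `s` is aperiodic. -/
theorem mul_eq_of_ideals (hN : 1 ≤ N) (hid : ∀ s : M, IsIdempotentElem (s ^ N))
    {p s q x x' y y' p₀ s₁ s₂ q₁ : M} (hp : p = p₀ * x) (hs₁ : s = y * s₁) (hs₂ : s = s₂ * x')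
    (hq : q = y' * q₁) (hl : leftIdeal x = leftIdeal x') (hr : rightIdeal y = rightIdeal y')
    (hx : x ∈ twoSided (p * s * q)) (hx' : x' ∈ twoSided (p * s * q))
    (hy : y ∈ twoSided (p * s * q)) (hy' : y' ∈ twoSided (p * s * q))
    (hap : s ^ N * s = s ^ N) : p * s = p ∧ s * q = q := by
  have sub : ∀ {z a b c : M}, z ∈ twoSided (p * s * q) → p * s * q = a * c * b → z ∈ twoSided c :=
    fun h e => twoSided_subset e h
  have h1 : leftIdeal p = leftIdeal x := by
    rw [hp]
    exact leftIdeal_mul_eq hN hid (hp ▸ sub (c := p) (a := 1) (b := s * q) hx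
      (by simp only [one_mul, mul_assoc]))
  have h2 : leftIdeal s = leftIdeal x' := by
    rw [hs₂]
    exact leftIdeal_mul_eq hN hid (hs₂ ▸ sub (c := s) (a := p) (b := q) hx' rfl)
  have h3 : rightIdeal s = rightIdeal y := by
    rw [hs₁]
    exact rightIdeal_mul_eq hN hid (hs₁ ▸ sub (c := s) (a := p) (b := q) hy rfl)
  have h4 : rightIdeal q = rightIdeal y' := by
    rw [hq]
    exact rightIdeal_mul_eq hN hid (hq ▸ sub (c := q) (a := p * s) (b := 1) hy' (by simp))
  -- By stability `p` and `s` are `L`-equivalent, and `s` and `q` are `R`-equivalent.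
  obtain ⟨z, hz⟩ : p ∈ leftIdeal s := by rw [h2, ← hl, ← h1]; exact mem_leftIdeal_self p
  obtain ⟨z', hz'⟩ : q ∈ rightIdeal s := by rw [h3, hr, ← h4]; exact mem_rightIdeal_self q
  -- With `p = z * s` and `q = s * z'`, the product `p * s * q` passes through `s * s`. Hence `s *
  -- s` is in the `J`-class of `s`, so `s = s * s * c`; iterating this and using aperiodicity makes
  -- `s` idempotent.
  have hss : s * s = s := by
    have hmem : s ∈ twoSided (s * s) := by
      have h5 : x' ∈ twoSided (s * s) := by
        refine sub (c := s * s) (a := z) (b := s * z') hx' ?_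
        conv_lhs => rw [hz, hz']
        simp only [mul_assoc]
      obtain ⟨c, d, e⟩ := h5
      exact ⟨s₂ * c, d, by conv_lhs => rw [hs₂, e]
                           simp only [mul_assoc]⟩
    obtain ⟨c, hc⟩ : s ∈ rightIdeal (s * s) := by
      rw [rightIdeal_mul_eq hN hid hmem]; exact mem_rightIdeal_self s
    have h6 : s = s ^ N * s * c ^ N := eq_pow_mul_mul_pow hc N
    rw [hap] at h6
    calc s * s = s * (s ^ N * c ^ N) := by rw [← h6]
      _ = s ^ N * s * c ^ N := by rw [← mul_assoc, pow_mul_comm']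
      _ = s := by rw [hap, ← h6]
  constructor
  · rw [hz, mul_assoc, hss]
  · rw [hz', ← mul_assoc, hss]

end Ideals

-- Monotone words and their composition

section Factorization

variable {A : Type u} {M : Type v}

/-- A compatible order `r` on a finite monoid and a morphism `f` to it, such that inserting `x`
between two idempotent powers of `f u` is increasing as soon as `x` precedes `u` for the preorder
of `Σ_i` at rank `k`. The idempotent powers are those with exponent `N`. -/
structure InsertionOrder [Monoid M] (f : List A → M) (r : M → M → Prop) (k i N : ℕ) : Prop where
  map_nil : f [] = 1
  map_append : ∀ x y, f (x ++ y) = f x * f y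
  refl : ∀ s, r s s
  trans : ∀ s t u, r s t → r t u → r s u
  antisymm : ∀ s t, r s t → r t s → s = t
  mul : ∀ s s' t t', r s s' → r t t' → r (s * t) (s' * t')
  one_le : 1 ≤ N
  idem : ∀ s : M, IsIdempotentElem (s ^ N)
  le_insert : ∀ x u, WSim k i x u → r (f u ^ N) (f u ^ N * f x * f u ^ N)

/-- The image of `w` increases when `w` is replaced by a word that is above it for the preorder of
`Σ_{i+1}` at rank `K`. -/
def IsMonotoneAt (f : List A → M) (r : M → M → Prop) (i K : ℕ) (w : List A) : Prop :=
  ∀ w', WSim K (i + 1) w w' → r (f w) (f w')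

theorem IsMonotoneAt.mono {f : List A → M} {r : M → M → Prop} {i K K' : ℕ} (hK : K ≤ K')
    {w : List A} (h : IsMonotoneAt f r i K w) : IsMonotoneAt f r i K' w :=
  fun w' hw => h w' (hw.mono_rank hK)

namespace InsertionOrder

variable [Monoid M] {f : List A → M} {r : M → M → Prop} {k i N K : ℕ}

/-- Inserting `w` between powers of itself gives `s ^ N ≤ s ^ N * s`. Iterating this climbs from `s
^ N * s` back to `s ^ N * s ^ N = s ^ N`, and antisymmetry concludes. -/
theorem aperiodic (h : InsertionOrder f r k i N) (w : List A) : f w ^ N * f w = f w ^ N := by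
  set s := f w with hs
  have h1 : r (s ^ N) (s ^ N * s) := by
    have := h.le_insert w w (Sim.refl _ _ _ _)
    rwa [← hs, mul_assoc, ← pow_mul_comm', ← mul_assoc, (h.idem s).eq] at this
  have h2 : ∀ n, r (s ^ N * s) (s ^ N * s ^ (n + 1)) := by
    intro n
    induction n with
    | zero => simpa using h.refl _
    | succ n ih =>
      refine h.trans _ _ _ ih ?_
      have := h.mul _ _ _ _ h1 (h.refl (s ^ (n + 1)))
      rwa [mul_assoc, ← pow_succ'] at this
  refine (h.antisymm _ _ h1 ?_).symm
  have := h2 (N - 1)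
  rwa [Nat.sub_add_cancel h.one_le, (h.idem s).eq] at this

theorem isMonotoneAt_append (h : InsertionOrder f r k i N) {x y : List A}
    (hx : IsMonotoneAt f r i K x) (hy : IsMonotoneAt f r i K y) :
    IsMonotoneAt f r i (K + 1) (x ++ y) := by
  intro w' hw
  obtain ⟨x', y', rfl, hx', hy'⟩ := hw.exists_append
  rw [h.map_append, h.map_append]
  exact h.mul _ _ _ _ (hx _ hx') (hy _ hy')

/-- Insertion between powers of the empty word, whose image is `1`. -/
theorem isMonotoneAt_nil (h : InsertionOrder f r k i N) : IsMonotoneAt f r i k [] := by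
  intro w' hw
  simpa [h.map_nil] using h.le_insert w' [] hw.swap

theorem isMonotoneAt_singleton (h : InsertionOrder f r k i N) (a : A) :
    IsMonotoneAt f r i (k + 1) [a] := by
  intro w' hw
  obtain ⟨x, y, rfl, hx, hy⟩ := hw.2.1 [] a [] rfl
  have := h.mul _ _ _ _ (h.isMonotoneAt_nil x hx)
    (h.mul _ _ _ _ (h.refl (f [a])) (h.isMonotoneAt_nil y hy))
  simpa only [h.map_nil, one_mul, mul_one, ← h.map_append, List.singleton_append] using this

/-- The middle factor may be arbitrarily long: `f x` and `f y` absorb the powers of `f m`, and `m'`,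
which lies below `m` one level lower, is inserted between two idempotent powers of `f m`. -/
theorem isMonotoneAt_insert (h : InsertionOrder f r k i N) (hK : k ≤ K) {x m y : List A}
    (hx : IsMonotoneAt f r i K x) (hy : IsMonotoneAt f r i K y) (hxm : f x * f m = f x)
    (hmy : f m * f y = f y) : IsMonotoneAt f r i (K + 2) (x ++ m ++ y) := by
  intro w' hw
  obtain ⟨w₁, y', rfl, hw₁, hy'⟩ := hw.exists_append
  obtain ⟨x', m', rfl, hx', hm'⟩ := hw₁.exists_append
  have hx'' := hx _ hx'
  have hy'' := hy _ hy'.of_succ_rank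
  have hm := h.le_insert _ _ (hm'.mono_rank hK).swap
  simp only [h.map_append]
  have e1 : ∀ n, f x * f m ^ n = f x := by
    intro n
    induction n with
    | zero => simp
    | succ n ih => rw [pow_succ, ← mul_assoc, ih, hxm]
  have e2 : ∀ n, f m ^ n * f y = f y := by
    intro n
    induction n with
    | zero => simp
    | succ n ih => rw [pow_succ, mul_assoc, hmy, ih]
  have step := h.mul _ _ _ _ (h.mul _ _ _ _ (h.refl (f x)) hm) (h.refl (f y))
  rw [e1, ← mul_assoc, ← mul_assoc, e1, mul_assoc (f x * f m'), e2] at step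
  rw [hxm]
  exact h.trans _ _ _ step (h.mul _ _ _ _ (h.mul _ _ _ _ hx'' (h.refl _)) hy'')

end InsertionOrder

end Factorization

-- First and last occurrences of a relation between neighbours

section Chains

variable {B : Type*}

theorem isChain_or_exists_first (R : B → B → Prop) (l : List B) :
    l.IsChain (fun b c => ¬ R b c) ∨ ∃ x b c y, l = x ++ b :: c :: y ∧ R b c ∧
      (x ++ [b]).IsChain (fun b c => ¬ R b c) := by
  induction l with
  | nil => exact Or.inl .nil
  | cons a l ih =>
    cases l with
    | nil => exact Or.inl (.singleton a)
    | cons d l =>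
      by_cases had : R a d
      · exact Or.inr ⟨[], a, d, l, rfl, had, .singleton a⟩
      · rcases ih with ih | ⟨x, b, c, y, e, hbc, hc⟩
        · exact Or.inl (ih.cons_cons had)
        · refine Or.inr ⟨a :: x, b, c, y, by rw [e]; rfl, hbc, ?_⟩
          cases x with
          | nil =>
            simp only [List.nil_append, List.cons.injEq] at e
            obtain ⟨rfl, rfl⟩ := e
            exact (List.IsChain.singleton d).cons_cons had
          | cons d' x =>
            simp only [List.cons_append, List.cons.injEq] at e
            obtain ⟨rfl, rfl⟩ := e
            exact hc.cons_cons had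

theorem isChain_or_exists_last (R : B → B → Prop) (l : List B) :
    l.IsChain (fun b c => ¬ R b c) ∨ ∃ x b c y, l = x ++ b :: c :: y ∧ R b c ∧
      (c :: y).IsChain (fun b c => ¬ R b c) := by
  induction l with
  | nil => exact Or.inl .nil
  | cons a l ih =>
    rcases ih with ih | ⟨x, b, c, y, rfl, hbc, hc⟩
    · cases l with
      | nil => exact Or.inl (.singleton a)
      | cons d l =>
        by_cases had : R a d
        · exact Or.inr ⟨[], a, d, l, rfl, had, ih⟩
        · exact Or.inl (ih.cons_cons had)
    · exact Or.inr ⟨a :: x, b, c, y, rfl, hbc, hc⟩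

end Chains

-- A uniform rank for all words, by induction on the `J`-order

namespace InsertionOrder

variable {A : Type u} {M : Type v} [Monoid M] {f : List A → M} {r : M → M → Prop} {k i N K : ℕ}

/-- The Green classes that meet at the border of two consecutive blocks. -/
def borderType (f : List A → M) (b c : List A) : Set M × Set M :=
  (leftIdeal (f b), rightIdeal (f c))

theorem map_infix (h : InsertionOrder f r k i N) (x y z : List A) :
    twoSided (f (x ++ y ++ z)) ⊆ twoSided (f y) := by
  rw [h.map_append, h.map_append]
  exact twoSided_subset rfl

/-- Sequences of blocks all of whose factors lie in one `J`-class. -/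
theorem exists_isMonotoneAt_flatten [Finite M] (h : InsertionOrder f r k i N) (n K₀ : ℕ)
    (T : Finset (Set M × Set M)) :
    ∃ K, ∀ l : List (List A),
      (∀ b ∈ l, IsMonotoneAt f r i K₀ b ∧ (twoSided (f b)).ncard ≤ n) →
      n ≤ (twoSided (f l.flatten)).ncard →
      l.IsChain (fun b c => borderType f b c ∈ T) → IsMonotoneAt f r i K l.flatten := by
  classical
  induction T using Finset.induction_on with
  | empty =>
    -- With no border type allowed there is at most one block.
    refine ⟨max k K₀, fun l hl _ hc => ?_⟩
    match l, hl, hc with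
    | [], _, _ => exact h.isMonotoneAt_nil.mono (le_max_left _ _)
    | [b], hl, _ => simpa using (hl b (by simp)).1.mono (le_max_right _ _)
    | b :: c :: l, _, hc => simp at hc
  | insert τ T _ ih =>
    obtain ⟨K, hK⟩ := ih
    have hK' : ∀ l : List (List A),
        (∀ b ∈ l, IsMonotoneAt f r i K₀ b ∧ (twoSided (f b)).ncard ≤ n) →
        n ≤ (twoSided (f l.flatten)).ncard →
        l.IsChain (fun b c => borderType f b c ∈ insert τ T) →
        l.IsChain (fun b c => ¬ borderType f b c = τ) → IsMonotoneAt f r i (max k K) l.flatten := by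
      intro l h1 h2 h3 h4
      refine (hK l h1 h2 ?_).mono (le_max_right _ _)
      rw [List.isChain_iff_getElem] at h3 h4 ⊢
      intro m hm
      exact (Finset.mem_insert.1 (h3 m hm)).resolve_left (h4 m hm)
    refine ⟨max k K + 2, fun l hl hn hc => ?_⟩
    have hfac : ∀ {p q s : List (List A)}, l = p ++ q ++ s →
        twoSided (f l.flatten) ⊆ twoSided (f q.flatten) := by
      rintro p q s rfl
      simpa using h.map_infix p.flatten q.flatten s.flatten
    have hsub : ∀ {p q s : List (List A)}, l = p ++ q ++ s →
        (∀ b ∈ q, IsMonotoneAt f r i K₀ b ∧ (twoSided (f b)).ncard ≤ n) ∧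
        n ≤ (twoSided (f q.flatten)).ncard ∧
        q.IsChain (fun b c => borderType f b c ∈ insert τ T) := by
      intro p q s e
      refine ⟨fun b hb => hl b (by simp [e, hb]), hn.trans (Set.ncard_le_ncard (hfac e)
        (Set.toFinite _)), hc.infix ⟨p, s, e.symm⟩⟩
    -- The word is cut at the first and at the last border of type `τ`. The outer parts avoid `τ`
    -- and fall under the induction hypothesis; the part between them is absorbed, whatever its
    -- length.
    rcases isChain_or_exists_first (fun b c => borderType f b c = τ) l with
      h1 | ⟨l₁, b, c, l₂, rfl, hbc, h1⟩
    · exact (hK' l hl hn hc h1).mono (by omega)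
    obtain ⟨a1, a2, a3⟩ := hsub (p := []) (q := l₁ ++ [b]) (s := c :: l₂) (by simp)
    have g1 := hK' _ a1 a2 a3 h1
    rcases isChain_or_exists_last (fun b c => borderType f b c = τ) (c :: l₂) with
      h2 | ⟨l₃, b', c', l₄, e, hbc', h2⟩
    · obtain ⟨a1, a2, a3⟩ := hsub (p := l₁ ++ [b]) (q := c :: l₂) (s := []) (by simp)
      have g2 := hK' _ a1 a2 a3 h2
      have := (h.isMonotoneAt_append g1 g2).mono (K' := max k K + 2) (by omega)
      simpa using this
    · obtain ⟨a1, a2, a3⟩ := hsub (p := l₁ ++ [b] ++ (l₃ ++ [b'])) (q := c' :: l₄) (s := [])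
        (by simp [e])
      have g2 := hK' _ a1 a2 a3 h2
      set m := (l₃ ++ [b']).flatten with hm
      have htot : (l₁ ++ b :: c :: l₂).flatten =
          (l₁ ++ [b]).flatten ++ m ++ (c' :: l₄).flatten := by
        simp [e, hm]
      -- The ideal of the whole product is contained in that of each block and has at least `n`
      -- elements, while the latter has at most `n`; hence the two are equal.
      have hmem : ∀ d ∈ l₁ ++ b :: c :: l₂, f d ∈ twoSided (f (l₁ ++ b :: c :: l₂).flatten) := by
        intro d hd
        obtain ⟨p, q, hpq⟩ := List.append_of_mem hd
        have hle := hfac (p := p) (q := [d]) (s := q) (by simp [hpq])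
        rw [List.flatten_singleton] at hle
        rw [Set.eq_of_subset_of_ncard_le hle ((hl d hd).2.trans hn) (Set.toFinite _)]
        exact mem_twoSided_self _
      have hab := hbc.trans hbc'.symm
      simp only [borderType, Prod.mk.injEq] at hab
      have hmc : ∃ s₁, m = c ++ s₁ := by
        cases l₃ with
        | nil =>
          simp only [List.nil_append, List.cons.injEq] at e
          exact ⟨[], by simp [hm, e.1]⟩
        | cons d l₃ =>
          simp only [List.cons_append, List.cons.injEq] at e
          exact ⟨(l₃ ++ [b']).flatten, by simp [hm, e.1]⟩
      obtain ⟨s₁, hs₁⟩ := hmc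
      have htot' : f (l₁ ++ b :: c :: l₂).flatten =
          f (l₁ ++ [b]).flatten * f m * f (c' :: l₄).flatten := by
        rw [htot, h.map_append, h.map_append]
      rw [htot'] at hmem
      have hb' : b' ∈ c :: l₂ := by rw [e]; simp
      have hc' : c' ∈ c :: l₂ := by rw [e]; simp
      obtain ⟨hpm, hmq⟩ := mul_eq_of_ideals h.one_le h.idem
        (p := f (l₁ ++ [b]).flatten) (s := f m) (q := f (c' :: l₄).flatten)
        (x := f b) (x' := f b') (y := f c) (y' := f c') (p₀ := f l₁.flatten) (s₁ := f s₁)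
        (s₂ := f l₃.flatten) (q₁ := f l₄.flatten)
        (by simp [h.map_append]) (by rw [hs₁, h.map_append]) (by simp [hm, h.map_append])
        (by simp [h.map_append]) hab.1 hab.2 (hmem _ (by simp))
        (hmem _ (List.mem_append_right _ (List.mem_cons_of_mem _ hb'))) (hmem _ (by simp))
        (hmem _ (List.mem_append_right _ (List.mem_cons_of_mem _ hc'))) (h.aperiodic m)
      rw [htot]
      exact h.isMonotoneAt_insert (le_max_left _ _) g1 g2 hpm hmq

/-- Every word is cut greedily into blocks that leave the set `H` with their last letter. -/
theorem exists_blocks (H : List A → Prop) (w : List A) :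
    ∃ (l : List (List A)) (x : List A), w = l.flatten ++ x ∧ (x = [] ∨ H x) ∧
      ∀ b ∈ l, ¬ H b ∧ ∃ y a, b = y ++ [a] ∧ (y = [] ∨ H y) := by
  induction w using List.reverseRecOn with
  | nil => exact ⟨[], [], rfl, Or.inl rfl, by simp⟩
  | append_singleton w a ih =>
    obtain ⟨l, x, rfl, hx, hl⟩ := ih
    by_cases hxa : H (x ++ [a])
    · exact ⟨l, x ++ [a], by simp, Or.inr hxa, hl⟩
    · refine ⟨l ++ [x ++ [a]], [], by simp, Or.inl rfl, fun b hb => ?_⟩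
      rcases List.mem_append.1 hb with hb | hb
      · exact hl b hb
      · rw [List.mem_singleton.1 hb]
        exact ⟨hxa, x, a, rfl, hx⟩

/-- The induction goes down by the size of the two-sided ideal of `f w`. A block is a word already
treated, or the empty one, followed by one letter, so its rank is bounded; the blocks together stay
in one `J`-class. -/
theorem exists_isMonotoneAt [Finite M] (h : InsertionOrder f r k i N) :
    ∃ K, ∀ w, IsMonotoneAt f r i K w := by
  classical
  have key : ∀ d, ∃ K, ∀ w, Nat.card M < (twoSided (f w)).ncard + d → IsMonotoneAt f r i K w := by
    intro d
    induction d with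
    | zero =>
      refine ⟨0, fun w hw => absurd hw ?_⟩
      have := Set.ncard_le_card (twoSided (f w))
      omega
    | succ d ih =>
      obtain ⟨K, hK⟩ := ih
      set n := Nat.card M - d with hn
      have hhigh : ∀ x, x = [] ∨ Nat.card M < (twoSided (f x)).ncard + d →
          IsMonotoneAt f r i (max k K + 1) x := by
        rintro x (rfl | hx)
        · exact h.isMonotoneAt_nil.mono (by omega)
        · exact (hK x hx).mono (by omega)
      have := Fintype.ofFinite (Set M × Set M)
      obtain ⟨K', hK'⟩ := h.exists_isMonotoneAt_flatten n (max k K + 2) Finset.univ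
      refine ⟨max (max k K + 1) K' + 1, fun w hw => ?_⟩
      obtain ⟨l, x, rfl, hx, hl⟩ :=
        exists_blocks (fun x => Nat.card M < (twoSided (f x)).ncard + d) w
      refine h.isMonotoneAt_append ((hK' l ?_ ?_ ?_).mono (le_max_right _ _))
        ((hhigh x hx).mono (le_max_left _ _))
      · intro b hb
        obtain ⟨hb, y, a, rfl, hy⟩ := hl b hb
        exact ⟨h.isMonotoneAt_append (hhigh y hy)
          ((h.isMonotoneAt_singleton a).mono (by omega)), by omega⟩
      · have h1 := Set.ncard_le_ncard (h.map_infix [] l.flatten x) (Set.toFinite _)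
        simp only [List.nil_append] at h1
        omega
      · rw [List.isChain_iff_getElem]
        exact fun m hm => Finset.mem_univ _
  -- With this depth the condition on the size of the ideal is void.
  obtain ⟨K, hK⟩ := key (Nat.card M + 1)
  exact ⟨K, fun w => hK w (by omega)⟩

end InsertionOrder

-- The syntactic monoid and the algebraic characterization

section SyntacticMonoid

variable {A : Type u} {M : Type v}

theorem exists_isIdempotentElem_pow [Monoid M] [Finite M] (s : M) :
    ∃ n, 1 ≤ n ∧ IsIdempotentElem (s ^ n) := by
  obtain ⟨a, b, hab, e⟩ := Finite.exists_ne_map_eq_of_infinite fun n : ℕ => s ^ n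
  wlog hlt : a < b generalizing a b
  · exact this b a hab.symm e.symm (by omega)
  obtain ⟨d, rfl⟩ : ∃ d, b = a + d := ⟨b - a, by omega⟩
  have hd : 1 ≤ d := by omega
  have key : ∀ m n, a ≤ n → s ^ (n + d * m) = s ^ n := by
    intro m n hn
    induction m with
    | zero => simp
    | succ m ih =>
      obtain ⟨c, rfl⟩ : ∃ c, n = a + c := ⟨n - a, by omega⟩
      rw [show a + c + d * (m + 1) = (a + d) + (c + d * m) by ring, pow_add, ← e, ← pow_add,
        ← add_assoc, ih]
  refine ⟨d * (a + 1), Nat.mul_pos hd (by omega), ?_⟩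
  rw [IsIdempotentElem, ← pow_add]
  exact key _ _ (by nlinarith)

theorem omegaExp_spec [Monoid M] [Finite M] :
    1 ≤ omegaExp M ∧ ∀ s : M, IsIdempotentElem (s ^ omegaExp M) := by
  classical
  have : ∃ n : ℕ, 1 ≤ n ∧ ∀ s : M, IsIdempotentElem (s ^ n) := by
    have := Fintype.ofFinite M
    choose n hn hs using exists_isIdempotentElem_pow (M := M)
    refine ⟨∏ s, n s, Nat.succ_le_iff.2 (Finset.prod_pos fun s _ => hn s), fun s => ?_⟩
    rw [← Finset.mul_prod_erase _ _ (Finset.mem_univ s), pow_mul]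
    exact (hs s).pow _
  rw [omegaExp, dif_pos this]
  exact Nat.find_spec this

/-- Words that act in the same way on the states of an automaton for `L` are syntactically
equivalent, and there are finitely many such actions. -/
theorem finite_syntacticMonoid {L : Language A} (hL : L.IsRegular) : Finite (SyntacticMonoid L) := by
  obtain ⟨σ, _, D, rfl⟩ := hL
  let act : FreeMonoid A → σ → σ := fun w s => D.evalFrom s w.toList
  have hact : ∀ w w', act w = act w' → syntacticMorphism D.accepts w =
      syntacticMorphism D.accepts w' := by
    have half : ∀ w w', act w = act w' → SyntacticLE D.accepts w w' := by
      intro w w' h u v huv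
      rw [DFA.mem_accepts] at huv ⊢
      have e : ∀ x : FreeMonoid A, D.eval (u * x * v).toList =
          D.evalFrom (act x (D.eval u.toList)) v.toList := by
        intro x
        simp [act, DFA.eval, DFA.evalFrom_of_append, FreeMonoid.toList_mul]
      rwa [e, ← h, ← e]
    exact fun w w' h => (Con.eq _).2 ⟨half w w' h, half w' w h.symm⟩
  refine Finite.of_injective (fun t : SyntacticMonoid D.accepts =>
    act (Function.surjInv (Con.mk'_surjective (c := syntacticCon D.accepts)) t)) fun s t h => ?_
  rw [← Function.surjInv_eq (Con.mk'_surjective (c := syntacticCon D.accepts)) s,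
    ← Function.surjInv_eq (Con.mk'_surjective (c := syntacticCon D.accepts)) t]
  exact hact _ _ h

/-- The image of a list in the syntactic monoid. -/
def synVal (L : Language A) (w : List A) : SyntacticMonoid L :=
  syntacticMorphism L (FreeMonoid.ofList w)

variable {L : Language A}

theorem synVal_append (x y : List A) : synVal L (x ++ y) = synVal L x * synVal L y := by
  rw [synVal, FreeMonoid.ofList_append, map_mul]
  rfl

theorem synVal_nil : synVal L [] = 1 := map_one _

theorem synVal_wordPow (u : List A) (n : ℕ) : synVal L (wordPow u n) = synVal L u ^ n := by
  induction n with
  | zero => exact synVal_nil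
  | succ n ih => rw [wordPow_succ, synVal_append, ih, pow_succ']

theorem synVal_surjective : Function.Surjective (synVal L) := fun t => by
  obtain ⟨w, rfl⟩ := Con.mk'_surjective (c := syntacticCon L) t
  exact ⟨w.toList, rfl⟩

theorem synVal_le_iff (w w' : List A) : synVal L w ≤ synVal L w' ↔
    ∀ u v, u ++ w ++ v ∈ L → u ++ w' ++ v ∈ L :=
  Iff.rfl

theorem syntacticMonoid_mul_le_mul {s s' t t' : SyntacticMonoid L} (h : s ≤ s') (h' : t ≤ t') :
    s * t ≤ s' * t' := by
  obtain ⟨w, rfl⟩ := synVal_surjective s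
  obtain ⟨w', rfl⟩ := synVal_surjective s'
  obtain ⟨x, rfl⟩ := synVal_surjective t
  obtain ⟨x', rfl⟩ := synVal_surjective t'
  exact SyntacticLE.mul h h'

theorem SigmaLE.mono {k l j : ℕ} (hkl : k ≤ l) {w w' : List A} (h : SigmaLE l j w w') :
    SigmaLE k j w w' :=
  fun φ h1 h2 => h φ h1 (h2.trans hkl)

theorem isSigmaChain_succ_iff (j : ℕ) (t s : SyntacticMonoid L) :
    IsSigmaChain (j + 1) (syntacticMorphism L) [t, s] ↔
      ∀ k, ∃ v u, SigmaLE k (j + 1) v u ∧ synVal L v = t ∧ synVal L u = s := by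
  refine forall_congr' fun k => ⟨?_, ?_⟩
  · rintro ⟨w, hw, e⟩
    match w, hw, e with
    | [v, u], hw, e =>
      simp only [List.map_cons, List.map_nil, List.cons.injEq, and_true] at e
      exact ⟨v.toList, u.toList, by simpa using hw, e.1, e.2⟩
  · rintro ⟨v, u, h, rfl, rfl⟩
    exact ⟨[FreeMonoid.ofList v, FreeMonoid.ofList u], by simpa using h, rfl⟩

theorem IsSigmaChain.exists_wSim {j : ℕ} {t s : SyntacticMonoid L}
    (h : IsSigmaChain j (syntacticMorphism L) [t, s]) (k : ℕ) :
    ∃ v u, WSim k j v u ∧ synVal L v = t ∧ synVal L u = s := by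
  cases j with
  | zero =>
    obtain ⟨v, rfl⟩ := synVal_surjective t
    obtain ⟨u, rfl⟩ := synVal_surjective s
    exact ⟨v, u, Sim.zero_right_iff.2 (by simp), rfl, rfl⟩
  | succ j =>
    obtain ⟨v, u, h, hv, hu⟩ := (isSigmaChain_succ_iff j t s).1 h k
    exact ⟨v, u, h.wSim, hv, hu⟩

/-- A pair that is not a chain is excluded at some rank, and there are finitely many pairs. -/
theorem exists_rank_isSigmaChain [Finite (SyntacticMonoid L)] (j : ℕ) :
    ∃ k, ∀ v u, WSim k j v u →
      IsSigmaChain j (syntacticMorphism L) [synVal L v, synVal L u] := by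
  cases j with
  | zero => exact ⟨0, fun _ _ _ => trivial⟩
  | succ j =>
    have : ∀ p : SyntacticMonoid L × SyntacticMonoid L, ∃ k, ∀ v u, SigmaLE k (j + 1) v u →
        (synVal L v, synVal L u) = p → IsSigmaChain (j + 1) (syntacticMorphism L) [p.1, p.2] := by
      intro p
      by_contra! hp
      obtain ⟨_, _, _, _, hnot⟩ := hp 0
      refine hnot ((isSigmaChain_succ_iff j _ _).2 fun k => ?_)
      obtain ⟨v, u, h, e, _⟩ := hp k
      exact ⟨v, u, h, congrArg Prod.fst e, congrArg Prod.snd e⟩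
    choose k hk using this
    obtain ⟨K, hK⟩ := (Set.finite_range k).bddAbove
    exact ⟨K, fun v u h => hk _ v u (h.sigmaLE.mono (hK ⟨_, rfl⟩)) rfl⟩

theorem wSim_pow_insert {j k N : ℕ} (hN : 1 ≤ N)
    (hid : ∀ s : SyntacticMonoid L, IsIdempotentElem (s ^ N)) {t s : SyntacticMonoid L}
    (h : IsSigmaChain j (syntacticMorphism L) [t, s]) :
    ∃ w w', WSim k (j + 1) w w' ∧ synVal L w = s ^ N ∧ synVal L w' = s ^ N * t * s ^ N := by
  obtain ⟨v, u, hvu, rfl, rfl⟩ := h.exists_wSim k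
  -- Exponents that are multiples of `N` have image `s ^ N`, and can be taken as long as the
  -- insertion lemma requires.
  have hpow : ∀ n, synVal L (wordPow u (N * (n + 1))) = synVal L u ^ N := by
    intro n
    rw [synVal_wordPow, pow_mul, (hid _).pow_succ_eq]
  have hle : 2 ^ k ≤ N * (2 ^ k + 1) + 1 := by
    have := Nat.mul_le_mul_right (2 ^ k + 1) hN
    omega
  exact ⟨_, _, WSim.wordPow_insert (u := u) k j hvu _ _ _ hle hle hle, hpow _, by
    rw [synVal_append, synVal_append, hpow]⟩

theorem WSim.context {k j : ℕ} {w w' : List A} (h : WSim k j w w') (u v : List A) :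
    WSim k j (u ++ w ++ v) (u ++ w' ++ v) :=
  ((Sim.refl _ _ _ u).append h).append (Sim.refl _ _ _ v)

theorem sigmaDefinable_iff_syntacticMonoid [Finite A] (hL : L.IsRegular) (j : ℕ) :
    SigmaDefinable (j + 1) L ↔
      ∀ t s : SyntacticMonoid L, IsSigmaChain j (syntacticMorphism L) [t, s] →
        s ^ omegaExp (SyntacticMonoid L) ≤
          s ^ omegaExp (SyntacticMonoid L) * t * s ^ omegaExp (SyntacticMonoid L) := by
  have := finite_syntacticMonoid hL
  obtain ⟨hN, hid⟩ := omegaExp_spec (M := SyntacticMonoid L)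
  rw [sigmaDefinable_iff]
  constructor
  · rintro ⟨k, hk⟩ t s hts
    obtain ⟨w, w', h, e, e'⟩ := wSim_pow_insert (k := k) hN hid hts
    rw [← e', ← e, synVal_le_iff]
    exact fun u v => hk _ _ (h.context u v)
  · intro H
    obtain ⟨k, hk⟩ := exists_rank_isSigmaChain (L := L) j
    have ho : InsertionOrder (synVal L) (· ≤ ·) k j (omegaExp (SyntacticMonoid L)) :=
      { map_nil := synVal_nil
        map_append := synVal_append
        refl := le_refl
        trans := fun _ _ _ => le_trans
        antisymm := fun _ _ => le_antisymm
        mul := fun _ _ _ _ => syntacticMonoid_mul_le_mul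
        one_le := hN
        idem := hid
        le_insert := fun x u h => H _ _ (hk x u h) }
    obtain ⟨K, hK⟩ := ho.exists_isMonotoneAt
    refine ⟨K, fun w w' h hw => ?_⟩
    simpa using (synVal_le_iff w w').1 (hK w w' h) [] [] (by simpa using hw)

theorem piDefinable_iff_syntacticMonoid [Finite A] (hL : L.IsRegular) (j : ℕ) :
    PiDefinable (j + 1) L ↔
      ∀ t s : SyntacticMonoid L, IsSigmaChain j (syntacticMorphism L) [t, s] →
        s ^ omegaExp (SyntacticMonoid L) * t * s ^ omegaExp (SyntacticMonoid L) ≤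
          s ^ omegaExp (SyntacticMonoid L) := by
  have := finite_syntacticMonoid hL
  obtain ⟨hN, hid⟩ := omegaExp_spec (M := SyntacticMonoid L)
  rw [piDefinable_iff]
  constructor
  · rintro ⟨k, hk⟩ t s hts
    obtain ⟨w, w', h, e, e'⟩ := wSim_pow_insert (k := k) hN hid hts
    rw [← e', ← e, synVal_le_iff]
    exact fun u v => hk _ _ (h.context u v)
  · intro H
    obtain ⟨k, hk⟩ := exists_rank_isSigmaChain (L := L) j
    -- The same machinery is applied to the reversed order.
    have ho : InsertionOrder (synVal L) (· ≥ ·) k j (omegaExp (SyntacticMonoid L)) :=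
      { map_nil := synVal_nil
        map_append := synVal_append
        refl := le_refl
        trans := fun _ _ _ h h' => le_trans h' h
        antisymm := fun _ _ h h' => le_antisymm h' h
        mul := fun _ _ _ _ => syntacticMonoid_mul_le_mul
        one_le := hN
        idem := hid
        le_insert := fun x u h => H _ _ (hk x u h) }
    obtain ⟨K, hK⟩ := ho.exists_isMonotoneAt
    refine ⟨K, fun w w' h hw => ?_⟩
    simpa using (synVal_le_iff w' w).1 (hK w w' h) [] [] (by simpa using hw)

end SyntacticMonoid

end WordLogic

open WordLogic
theorem corollary2 {A : Type*} [Finite A] (L : Language A) (hL : L.IsRegular)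
    (i : ℕ) (hi : 1 ≤ i) :
    (PiDefinable i L ↔
      ∀ t s : SyntacticMonoid L, IsSigmaChain (i - 1) (syntacticMorphism L) [t, s] →
        s ^ omegaExp (SyntacticMonoid L) * t * s ^ omegaExp (SyntacticMonoid L)
          ≤ s ^ omegaExp (SyntacticMonoid L)) ∧
    (DeltaDefinable i L ↔
      ∀ t s : SyntacticMonoid L, IsSigmaChain (i - 1) (syntacticMorphism L) [t, s] →
        s ^ omegaExp (SyntacticMonoid L)
          = s ^ omegaExp (SyntacticMonoid L) * t * s ^ omegaExp (SyntacticMonoid L)) := by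
  obtain ⟨j, rfl⟩ : ∃ j, i = j + 1 := ⟨i - 1, by omega⟩
  have hp := piDefinable_iff_syntacticMonoid hL j
  refine ⟨hp, ?_⟩
  rw [DeltaDefinable, sigmaDefinable_iff_syntacticMonoid hL, hp]
  exact ⟨fun h t s hts => le_antisymm (h.1 t s hts) (h.2 t s hts),
    fun h => ⟨fun t s hts => (h t s hts).le, fun t s hts => (h t s hts).ge⟩⟩
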